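/- Let $P_1,\dots,P_n$ ($n\ge 1$) be probability measures on a common space. Let $$\mathbb P_n=\frac1{n!}\sum_{\pi\in S_n} P_{\pi(1)}\otimes\cdots\otimes P_{\pi(n)},\qquad \mathbb Q_n=\Big(\frac1n\sum_{i=1}^n P_i\Big)^{\otimes n},$$ and let $\chi^2(P\|Q)=\int \frac{(\mathrm dP-\mathrm dQ)^2}{\mathrm dQ}$ (equal to $+\infty$ if $P\not\ll Q$). The following bounds hold for all $n\ge 1$ and all $P_1,\dots,P_n\in\mathcal P$; the constants hidden in $O(\cdot)$ are absolute, so they do not depend on $n$, on $P_1,\dots,P_n$, or on the parameters $\mu,\Theta,\varepsilon,M$. 1. Gaussian family $\mathcal P=\{\mathcal N(\theta,1):|\theta|\le\mu\}$: there is an absolute constant $\mu_c>0$ such that $$\chi^2(\mathbb P_n\|\mathbb Q_n)=\begin{cases}O(\mu^4)&\text{if }\mu\le\mu_c,\\ \exp(O(\mu^3))-1&\text{if }\mu>\mu_c.\end{cases}$$ 2. Gaussian family with finite support $\mathcal P=\{\mathcal N(\theta,1):|\theta|\le\mu,\ \theta\in\Theta\}$ with $|\Theta|<\infty$: there is an absolute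 constant $\mu_c>0$ (not depending on $\Theta$) such that $$\chi^2(\mathbb P_n\|\mathbb Q_n)=\begin{cases}O(\mu^4)&\text{if }\mu\le\mu_c,\\ \exp(O(|\Theta|\mu^2))-1&\text{if }\mu>\mu_c.\end{cases}$$ 3. Bernoulli family $\mathcal P=\{\mathrm{Bern}(p):p\in[\varepsilon,1-\varepsilon]\}$: there is an absolute constant $\varepsilon_c\in(0,1/2)$ such that $$\chi^2(\mathbb P_n\|\mathbb Q_n)=\begin{cases}O((1-2\varepsilon)^4)&\text{if }\varepsilon\ge\varepsilon_c,\\ O(1/\varepsilon)&\text{if }0<\varepsilon<\varepsilon_c.\end{cases}$$ 4. Poisson family $\mathcal P=\{\mathrm{Poi}(\lambda):\lambda\in[0,M]\}$: $$\chi^2(\mathbb P_n\|\mathbb Q_n)=\begin{cases}O(M^2)&\text{if }M\le 1,\\ \exp(O(M^{3/2}))-1&\text{if }M>1.\end{cases}$$ -/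

import Mathlib

open MeasureTheory ProbabilityTheory
open scoped ENNReal NNReal

/-- The `χ²` divergence `χ²(P‖Q) = ∫ (dP - dQ)² / dQ = ∫ (dP/dQ - 1)² dQ`, which is infinite when
`P` is not absolutely continuous with respect to `Q`. -/
noncomputable def chiSqDiv {Ω : Type*} [MeasurableSpace Ω] (P Q : Measure Ω) : ℝ≥0∞ :=
  open Classical in
  if P ≪ Q then ∫⁻ x, ENNReal.ofReal (((P.rnDeriv Q x).toReal - 1) ^ 2) ∂Q else ⊤

/-- The permutation mixture `ℙₙ = 𝔼_{π ∼ Unif(Sₙ)} [⨂ᵢ P_{π(i)}]`. -/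
noncomputable def permMixture {X : Type*} [MeasurableSpace X] {n : ℕ}
    (P : Fin n → Measure X) : Measure (Fin n → X) :=
  (n.factorial : ℝ≥0∞)⁻¹ • ∑ π : Equiv.Perm (Fin n), Measure.pi (fun i => P (π i))

/-- The i.i.d. counterpart `ℚₙ = ((1/n) ∑ᵢ Pᵢ)^{⊗ n}`. -/
noncomputable def iidMixture {X : Type*} [MeasurableSpace X] {n : ℕ}
    (P : Fin n → Measure X) : Measure (Fin n → X) :=
  Measure.pi (fun _ : Fin n => (n : ℝ≥0∞)⁻¹ • ∑ i, P i)

/-- The family `{N(θ, 1) : |θ| ≤ μ}`. -/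
def gaussianFamily (μ : ℝ) : Set (Measure ℝ) :=
  {P | ∃ θ : ℝ, |θ| ≤ μ ∧ P = gaussianReal θ 1}

/-- The family `{N(θ, 1) : |θ| ≤ μ, θ ∈ Θ}` for a finite set `Θ`. -/
def gaussianFiniteFamily (Θ : Finset ℝ) (μ : ℝ) : Set (Measure ℝ) :=
  {P | ∃ θ ∈ Θ, |θ| ≤ μ ∧ P = gaussianReal θ 1}

/-- The family `{Bern(p) : p ∈ [ε, 1 - ε]}`; the outcome `true` has probability `p`. -/
def bernoulliFamily (ε : ℝ) : Set (Measure Bool) :=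
  {P | ∃ p : unitInterval, (p : ℝ) ∈ Set.Icc ε (1 - ε) ∧ P = bernoulliMeasure true false p}

/-- The family `{Poi(lam) : lam ∈ [0, M]}`. -/
def poissonFamily (M : ℝ) : Set (Measure ℕ) :=
  {P | ∃ lam : ℝ≥0, (lam : ℝ) ≤ M ∧ P = poissonMeasure lam}

/-! Let `q` be the averaged density and `M i j = ∫ p_i p_j / q - 1`. Squaring the likelihood ratio
of the permutation mixture and integrating coordinate by coordinate gives `χ² + 1 = (1/n!) perm(1 +
M)`. The matrix `M` is positive semidefinite with zero row sums, so `(1 + M)/n` is doubly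
stochastic: it has eigenvalue 1 on the constants, and the remaining spectrum `l` has sum `tr M / n`.

The main estimate is `(1/n!) perm(1 + M) ≤ ∏ (1 - l_a)⁻¹` (`permMean_gram_le`). By Wick's formula
the permanent of a Gram matrix is the mean of a product of `n` squared moduli of complex Gaussian
linear forms. AM-GM replaces this product by a power of `|z₀|² + ∑ l_a |z_a|²`, where `z₀` belongs
to the constant direction. As `|z₀|²` is standard exponential, integrating it out of `(|z₀|² + y)^n
/ n!` leaves at most `e^y`, and `E exp(l_a |z_a|²) = (1 - l_a)⁻¹`.

Only a trace bound `tr M / n ≤ τ` and a lower bound on the entries of `1 + M` are then needed. If `τ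
< 1`, the product is at most `(1 - τ)⁻¹`. If `τ ≤ 1/2`, the bound improves to `χ² ≤ 4τ²`: the
polynomial `t ↦ (1/n!) perm(1 + tM)` has nonnegative coefficients and no linear term, so its excess
over 1 grows at least like `t²`, and `M` may be scaled up until the main estimate is of constant
order. If all entries of `1 + M` are at least `δ`, then `l_a ≤ 1 - δ`, and the product is at most
`exp(τ(2 + 2 log(1/δ)))`.

For each family, `τ` comes from the integral of an envelope of the densities or from pairwise `χ²`
divergences, and `δ` from Hellinger affinities by Cauchy–Schwarz. The exponents `μ³` and `M^(3/2)`
are the product of an envelope mass (order `μ`, `√M`) and a logarithmic inverse affinity (order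
`μ²`, `M`). -/

/-! ### Wick's formula for permanents of Gram matrices. -/

theorem card_perm_comp_eq {α ι : Type*} [Fintype α] [DecidableEq α] [Fintype ι] [DecidableEq ι]
    (f f' : α → ι) :
    Fintype.card {σ : Equiv.Perm α // f ∘ σ = f'} =
      ∏ a, if Fintype.card {x // f x = a} = Fintype.card {x // f' x = a} then
        (Fintype.card {x // f x = a}).factorial else 0 := by
  by_cases h : ∀ a, Fintype.card {x // f x = a} = Fintype.card {x // f' x = a}
  · simp only [h, if_true]
    have e : ∀ a, {x // f' x = a} ≃ {x // f x = a} := fun a =>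
      Fintype.equivOfCardEq (h a).symm
    -- One solution, obtained by matching fibers of equal size; all solutions then form a coset of
    -- the stabilizer of `f'`, whose order is the product of factorials.
    let σ₀ : Equiv.Perm α :=
      (Equiv.sigmaFiberEquiv f').symm.trans ((Equiv.sigmaCongrRight e).trans (Equiv.sigmaFiberEquiv f))
    have hσ₀ : f ∘ σ₀ = f' := by
      funext x
      exact (e (f' x) ⟨x, rfl⟩).2
    rw [← DomMulAct.stabilizer_card f']
    refine Fintype.card_congr ((Equiv.mulLeft σ₀⁻¹).subtypeEquiv fun σ => ?_)
    have : f' ∘ (Equiv.mulLeft σ₀⁻¹ σ) = f ∘ σ := by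
      rw [← hσ₀]; funext x; simp
    rw [this]
  · push Not at h
    obtain ⟨a, ha⟩ := h
    rw [Finset.prod_eq_zero (Finset.mem_univ a) (if_neg ha), Fintype.card_eq_zero_iff]
    refine ⟨fun ⟨σ, hσ⟩ => ha ?_⟩
    subst hσ
    exact (Fintype.card_congr (σ.subtypeEquiv fun x => by simp)).symm

/-- A complex variable with the moments of a standard complex Gaussian. -/
structure IsComplexGaussian {Ω : Type*} [MeasurableSpace Ω] (ρ : Measure Ω) (g : Ω → ℂ) : Prop where
  integrable (a b : ℕ) : Integrable (fun x => g x ^ a * (starRingEnd ℂ (g x)) ^ b) ρ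
  moment (a b : ℕ) : ∫ x, g x ^ a * (starRingEnd ℂ (g x)) ^ b ∂ρ = if a = b then (a.factorial : ℂ) else 0

theorem prod_comp_eq_prod_pow_card {α ι M : Type*} [Fintype α] [Fintype ι] [DecidableEq ι]
    [CommMonoid M] (f : α → ι) (z : ι → M) :
    ∏ i, z (f i) = ∏ a, z a ^ Fintype.card {x // f x = a} := by
  rw [← Finset.prod_fiberwise' Finset.univ f z]
  refine Finset.prod_congr rfl fun a _ => ?_
  rw [Finset.prod_const, Fintype.card_subtype]

section Wick
variable {Ω : Type*} [MeasurableSpace Ω] {ρ : Measure Ω} [IsProbabilityMeasure ρ] {g : Ω → ℂ}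
  {κ : Type*} [Fintype κ] [DecidableEq κ] {α : Type*} [Fintype α] [DecidableEq α]

/-- Each factor is a form times its conjugate; distributing, `f` records the choices in the forms
and `f'` those in the conjugates. Only fiber sizes enter the monomials, so Gaussian moments apply.
-/
theorem prod_normSq_sum_eq (v : α → κ → ℝ) (z : κ → ℂ) :
    ((∏ i, ‖∑ a, (v i a : ℂ) * z a‖ ^ 2 : ℝ) : ℂ) =
      ∑ f : α → κ, ∑ f' : α → κ, (∏ i, ((v i (f i) : ℂ) * v i (f' i))) *
        ∏ a, (z a ^ Fintype.card {x // f x = a} *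
          (starRingEnd ℂ (z a)) ^ Fintype.card {x // f' x = a}) := by
  have h : ∀ i, ((‖∑ a, (v i a : ℂ) * z a‖ ^ 2 : ℝ) : ℂ) =
      (∑ a, (v i a : ℂ) * z a) * (∑ a, (v i a : ℂ) * starRingEnd ℂ (z a)) := by
    intro i
    push_cast
    rw [← Complex.mul_conj']
    simp
  rw [Complex.ofReal_prod]
  simp_rw [h]
  rw [Finset.prod_mul_distrib, Finset.prod_univ_sum, Finset.prod_univ_sum, Finset.sum_mul_sum]
  simp only [Fintype.piFinset_univ]
  refine Finset.sum_congr rfl fun f _ => Finset.sum_congr rfl fun f' _ => ?_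
  rw [Finset.prod_mul_distrib, Finset.prod_mul_distrib, Finset.prod_mul_distrib,
    Finset.prod_mul_distrib, prod_comp_eq_prod_pow_card f z,
    prod_comp_eq_prod_pow_card f' (fun a => starRingEnd ℂ (z a))]
  ring

/-- The permanent expands over the same pairs `(f, f')`, weighted by the number of `σ` with `f ∘ σ =
f'`. That number is exactly the Gaussian moment of the corresponding monomial, whence Wick's
formula. -/
theorem sum_perm_prod_sum_eq (v : α → κ → ℝ) :
    ∑ σ : Equiv.Perm α, ∏ i, ∑ a, v i a * v (σ i) a =
      ∑ f : α → κ, ∑ f' : α → κ, (∏ i, (v i (f i) * v i (f' i))) *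
        ∏ a, if Fintype.card {x // f x = a} = Fintype.card {x // f' x = a} then
          ((Fintype.card {x // f x = a}).factorial : ℝ) else 0 := by
  have hc : ∀ f f' : α → κ, (∏ a, if Fintype.card {x // f x = a} = Fintype.card {x // f' x = a} then
          ((Fintype.card {x // f x = a}).factorial : ℝ) else 0) =
        ∑ σ : Equiv.Perm α, if f ∘ σ = f' then (1 : ℝ) else 0 := by
    intro f f'
    rw [Finset.sum_boole, ← Fintype.card_subtype, card_perm_comp_eq]
    push_cast
    rfl
  simp_rw [hc, Finset.prod_univ_sum, Fintype.piFinset_univ, Finset.mul_sum]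
  rw [Finset.sum_comm]
  refine Finset.sum_congr rfl fun f _ => ?_
  rw [Finset.sum_comm]
  -- Passing to `σ⁻¹` turns the second factor into `v i (f (σ i))`, so that `f' = f ∘ σ`.
  rw [← Equiv.sum_comp (Equiv.inv (Equiv.Perm α))]
  refine Finset.sum_congr rfl fun σ _ => ?_
  simp only [mul_ite, mul_one, mul_zero, Finset.sum_ite_eq, Finset.mem_univ, if_true]
  rw [Finset.prod_mul_distrib, Finset.prod_mul_distrib]
  congr 1
  rw [← Equiv.prod_comp σ]
  simp

theorem IsComplexGaussian.integrable_prod (hg : IsComplexGaussian ρ g) (v : α → κ → ℝ) :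
    Integrable (fun ω : κ → Ω => ∏ i, ‖∑ a, (v i a : ℂ) * g (ω a)‖ ^ 2)
      (Measure.pi fun _ => ρ) := by
  have : Integrable (fun ω : κ → Ω => ((∏ i, ‖∑ a, (v i a : ℂ) * g (ω a)‖ ^ 2 : ℝ) : ℂ))
      (Measure.pi fun _ => ρ) := by
    simp_rw [prod_normSq_sum_eq]
    refine integrable_finsetSum _ fun f _ => integrable_finsetSum _ fun f' _ => ?_
    refine Integrable.const_mul ?_ _
    exact Integrable.fintype_prod (f := fun a x => g x ^ Fintype.card {x // f x = a} *
          (starRingEnd ℂ (g x)) ^ Fintype.card {x // f' x = a}) fun a => hg.integrable _ _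
  exact this.re

/-- Wick's formula: the expected squared modulus of a product of linear forms in independent
complex Gaussians is the permanent of their covariance matrix. -/
theorem IsComplexGaussian.integral_prod (hg : IsComplexGaussian ρ g) (v : α → κ → ℝ) :
    ∫ ω : κ → Ω, ∏ i, ‖∑ a, (v i a : ℂ) * g (ω a)‖ ^ 2 ∂(Measure.pi fun _ => ρ) =
      ∑ σ : Equiv.Perm α, ∏ i, ∑ a, v i a * v (σ i) a := by
  apply Complex.ofReal_injective
  rw [← integral_complex_ofReal, sum_perm_prod_sum_eq]
  simp_rw [prod_normSq_sum_eq]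
  have hi : ∀ f f' : α → κ, Integrable (fun ω : κ → Ω =>
      (∏ i, ((v i (f i) : ℂ) * v i (f' i))) * ∏ a, (g (ω a) ^ Fintype.card {x // f x = a} *
          (starRingEnd ℂ (g (ω a))) ^ Fintype.card {x // f' x = a})) (Measure.pi fun _ => ρ) :=
    fun f f' => Integrable.const_mul (Integrable.fintype_prod
      (f := fun a x => g x ^ Fintype.card {x // f x = a} *
          (starRingEnd ℂ (g x)) ^ Fintype.card {x // f' x = a}) fun a => hg.integrable _ _) _
  rw [integral_finsetSum _ fun f _ => integrable_finsetSum _ fun f' _ => hi f f', Complex.ofReal_sum]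
  refine Finset.sum_congr rfl fun f _ => ?_
  rw [integral_finsetSum _ fun f' _ => hi f f', Complex.ofReal_sum]
  refine Finset.sum_congr rfl fun f' _ => ?_
  rw [integral_const_mul, integral_fintype_prod_eq_prod
    (fun a x => g x ^ Fintype.card {x // f x = a} *
          (starRingEnd ℂ (g x)) ^ Fintype.card {x // f' x = a})]
  simp_rw [hg.moment]
  push_cast
  congr 1
  refine Finset.prod_congr rfl fun a _ => ?_
  split_ifs <;> simp

end Wick

/-! ### The standard complex Gaussian in polar form and its exponential moments. -/

/-- The standard exponential distribution. -/
noncomputable def stdExp : Measure ℝ :=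
  (volume.restrict (Set.Ioi 0)).withDensity fun s => ENNReal.ofReal (Real.exp (-s))

/-- The uniform distribution on an interval of length `2π`. -/
noncomputable def uniformAngle : Measure ℝ :=
  (ENNReal.ofReal (2 * Real.pi))⁻¹ • volume.restrict (Set.Ioc 0 (2 * Real.pi))

/-- The complex number with squared modulus `p.1` and argument `p.2`. -/
noncomputable def sqrtPolar (p : ℝ × ℝ) : ℂ := (√p.1 : ℂ) * Complex.exp (p.2 * Complex.I)

theorem lintegral_stdExp {F : ℝ → ℝ≥0∞} (hF : Measurable F) :
    ∫⁻ s, F s ∂stdExp = ∫⁻ s in Set.Ioi 0, ENNReal.ofReal (Real.exp (-s)) * F s := by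
  rw [stdExp, lintegral_withDensity_eq_lintegral_mul _ (by fun_prop) hF]
  rfl

theorem integrableOn_pow_mul_exp_neg (n : ℕ) :
    IntegrableOn (fun s : ℝ => Real.exp (-s) * s ^ n) (Set.Ioi 0) := by
  have := Real.GammaIntegral_convergent (s := n + 1) (by positivity)
  simpa using this

theorem integral_pow_mul_exp_neg (n : ℕ) :
    ∫ s in Set.Ioi (0 : ℝ), Real.exp (-s) * s ^ n = n.factorial := by
  have := Real.Gamma_eq_integral (s := n + 1) (by positivity)
  rw [Real.Gamma_nat_eq_factorial] at this
  simpa using this.symm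

theorem integrable_stdExp_iff {F : ℝ → ℂ} :
    Integrable F stdExp ↔ IntegrableOn (fun s => (Real.exp (-s) : ℂ) * F s) (Set.Ioi 0) := by
  rw [stdExp, integrable_withDensity_iff_integrable_smul' (by fun_prop) (by simp)]
  simp only [ENNReal.toReal_ofReal (Real.exp_nonneg _), Complex.real_smul, IntegrableOn]

theorem integral_stdExp (F : ℝ → ℂ) :
    ∫ s, F s ∂stdExp = ∫ s in Set.Ioi 0, (Real.exp (-s) : ℂ) * F s := by
  rw [stdExp, integral_withDensity_eq_integral_toReal_smul (by fun_prop) (by simp)]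
  simp only [ENNReal.toReal_ofReal (Real.exp_nonneg _), Complex.real_smul]

instance : IsProbabilityMeasure stdExp := by
  refine ⟨?_⟩
  rw [← lintegral_one, lintegral_stdExp measurable_const]
  simp only [mul_one]
  rw [← ofReal_integral_eq_lintegral_ofReal]
  · have := integral_pow_mul_exp_neg 0
    simp only [pow_zero, mul_one, Nat.factorial_zero, Nat.cast_one] at this
    rw [this]; simp
  · simpa [IntegrableOn] using integrableOn_pow_mul_exp_neg 0
  · exact Filter.Eventually.of_forall fun _ => (Real.exp_nonneg _)

instance : IsProbabilityMeasure uniformAngle := by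
  refine ⟨?_⟩
  rw [uniformAngle, Measure.smul_apply, Measure.restrict_apply_univ, Real.volume_Ioc, sub_zero,
    smul_eq_mul]
  exact ENNReal.inv_mul_cancel (by simp [Real.pi_pos]) ENNReal.ofReal_ne_top

theorem integral_uniformAngle_exp (a b : ℕ) :
    ∫ φ, Complex.exp (φ * Complex.I) ^ a * (starRingEnd ℂ (Complex.exp (φ * Complex.I))) ^ b
      ∂uniformAngle = if a = b then 1 else 0 := by
  have h : ∀ φ : ℝ, Complex.exp (φ * Complex.I) ^ a *
      (starRingEnd ℂ (Complex.exp (φ * Complex.I))) ^ b =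
      Complex.exp ((((a : ℂ) - b) * Complex.I) * φ) := by
    intro φ
    rw [← Complex.exp_conj, ← Complex.exp_nat_mul, ← Complex.exp_nat_mul, ← Complex.exp_add]
    congr 1
    simp
    ring
  simp_rw [h]
  split_ifs with hab
  · simp [hab]
  · rw [uniformAngle, integral_smul_measure, ← intervalIntegral.integral_of_le (by positivity),
      integral_exp_mul_complex]
    · have : Complex.exp (((a : ℂ) - b) * Complex.I * ((2 * Real.pi : ℝ) : ℂ)) = 1 := by
        rw [Complex.exp_eq_one_iff]
        exact ⟨(a : ℤ) - b, by push_cast; ring⟩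
      rw [this]; simp
    · simpa [sub_eq_zero] using hab

/-- The law of modulus and argument of a standard complex Gaussian. -/
noncomputable abbrev polarGaussian : Measure (ℝ × ℝ) := stdExp.prod uniformAngle

/-- The uniform phase kills the moments with `a ≠ b`; for `a = b` the radial part is the Gamma
integral `∫ e^{-s} s^a = a!`. -/
theorem isComplexGaussian_sqrtPolar : IsComplexGaussian polarGaussian sqrtPolar := by
  have h : ∀ (a b : ℕ) (p : ℝ × ℝ), sqrtPolar p ^ a * (starRingEnd ℂ (sqrtPolar p)) ^ b =
      (√p.1 : ℂ) ^ (a + b) * (Complex.exp (p.2 * Complex.I) ^ a *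
        (starRingEnd ℂ (Complex.exp (p.2 * Complex.I))) ^ b) := by
    intro a b p
    simp only [sqrtPolar, map_mul, Complex.conj_ofReal]
    ring
  constructor
  · intro a b
    simp_rw [h]
    refine Integrable.mul_prod (f := fun s : ℝ => (√s : ℂ) ^ (a + b))
      (g := fun φ : ℝ => Complex.exp (φ * Complex.I) ^ a *
        (starRingEnd ℂ (Complex.exp (φ * Complex.I))) ^ b) ?_ ?_
    · rw [integrable_stdExp_iff]
      have := Real.GammaIntegral_convergent (s := ((a + b : ℕ) : ℝ) / 2 + 1) (by positivity)
      refine IntegrableOn.congr_fun (f := fun s : ℝ =>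
        ((Real.exp (-s) * s ^ (((a + b : ℕ) : ℝ) / 2 + 1 - 1) : ℝ) : ℂ))
        (Integrable.ofReal this) (fun s hs => ?_) measurableSet_Ioi
      simp only [add_sub_cancel_right]
      rw [← Complex.ofReal_pow, Real.sqrt_eq_rpow, ← Real.rpow_natCast, ← Real.rpow_mul (le_of_lt hs)]
      push_cast
      norm_num
      congr 1
      ring
    · refine Integrable.of_bound (C := 1) (by fun_prop) (Filter.Eventually.of_forall fun φ => ?_)
      simp [Complex.norm_exp]
  · intro a b
    simp_rw [h]
    rw [integral_prod_mul (fun s : ℝ => (√s : ℂ) ^ (a + b))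
      (fun φ : ℝ => Complex.exp (φ * Complex.I) ^ a *
        (starRingEnd ℂ (Complex.exp (φ * Complex.I))) ^ b), integral_uniformAngle_exp]
    split_ifs with hab
    · subst hab
      rw [mul_one, integral_stdExp, ← Complex.ofReal_natCast, ← integral_pow_mul_exp_neg,
        ← integral_complex_ofReal]
      refine setIntegral_congr_fun measurableSet_Ioi fun s hs => ?_
      rw [← two_mul, pow_mul, ← Complex.ofReal_pow √s, Real.sq_sqrt (le_of_lt hs)]
      push_cast
      rfl
    · simp

theorem measurable_sqrtPolar : Measurable sqrtPolar := by
  unfold sqrtPolar; fun_prop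

theorem lintegral_normSq_sqrtPolar {F : ℝ → ℝ≥0∞} (hF : Measurable F) :
    ∫⁻ p, F (‖sqrtPolar p‖ ^ 2) ∂polarGaussian =
      ∫⁻ s in Set.Ioi 0, ENNReal.ofReal (Real.exp (-s)) * F s := by
  have h : ∀ p : ℝ × ℝ, ‖sqrtPolar p‖ ^ 2 = √p.1 ^ 2 := by
    intro p
    simp [sqrtPolar, Complex.norm_exp]
  simp_rw [h]
  rw [polarGaussian, lintegral_prod _ (by fun_prop)]
  simp only [lintegral_const, measure_univ, mul_one]
  rw [lintegral_stdExp (F := fun s => F (√s ^ 2)) (by fun_prop)]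
  refine setLIntegral_congr_fun measurableSet_Ioi fun s hs => ?_
  simp only [Real.sq_sqrt (le_of_lt hs)]

theorem lintegral_exp_mul_normSq {t : ℝ} (ht : t < 1) :
    ∫⁻ p, ENNReal.ofReal (Real.exp (t * ‖sqrtPolar p‖ ^ 2)) ∂polarGaussian =
      ENNReal.ofReal (1 - t)⁻¹ := by
  rw [lintegral_normSq_sqrtPolar (F := fun x => ENNReal.ofReal (Real.exp (t * x))) (by fun_prop)]
  have h : ∀ s : ℝ, ENNReal.ofReal (Real.exp (-s)) * ENNReal.ofReal (Real.exp (t * s)) =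
      ENNReal.ofReal (Real.exp ((t - 1) * s)) := by
    intro s
    rw [← ENNReal.ofReal_mul (Real.exp_nonneg _), ← Real.exp_add]
    congr 2; ring
  simp_rw [h]
  rw [← ofReal_integral_eq_lintegral_ofReal (integrableOn_exp_mul_Ioi (by linarith) 0)
    (Filter.Eventually.of_forall fun _ => Real.exp_nonneg _),
    integral_exp_mul_Ioi (by linarith) 0]
  congr 1
  rw [mul_zero, Real.exp_zero, neg_div, ← div_neg, neg_sub, one_div]

/-- Substitute `u = s + y`: the weight `e^{-s}` becomes `e^y e^{-u}`, and enlarging the range `u >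
y` to `u > 0` gives `e^y Γ(n+1) / n!`. -/
theorem lintegral_add_pow_div_factorial_le {y : ℝ} (hy : 0 ≤ y) (n : ℕ) :
    ∫⁻ p, ENNReal.ofReal ((‖sqrtPolar p‖ ^ 2 + y) ^ n / n.factorial) ∂polarGaussian ≤
      ENNReal.ofReal (Real.exp y) := by
  rw [lintegral_normSq_sqrtPolar (F := fun x => ENNReal.ofReal ((x + y) ^ n / n.factorial))
    (by fun_prop)]
  let G : ℝ → ℝ≥0∞ := fun u => (Set.Ioi (0 : ℝ)).indicator
    (fun u => ENNReal.ofReal (Real.exp (-u) * u ^ n)) u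
  have hG : Measurable G := Measurable.indicator (by fun_prop) measurableSet_Ioi
  have hfac : (0 : ℝ) < n.factorial := by positivity
  calc ∫⁻ s in Set.Ioi 0, ENNReal.ofReal (Real.exp (-s)) *
        ENNReal.ofReal ((s + y) ^ n / n.factorial)
      ≤ ∫⁻ s in Set.Ioi 0, ENNReal.ofReal (Real.exp y / n.factorial) * G (s + y) := by
        refine setLIntegral_mono (by fun_prop) fun s hs => ?_
        have hs' : 0 < s + y := add_pos_of_pos_of_nonneg hs hy
        simp only [G, Set.indicator_of_mem (show s + y ∈ Set.Ioi (0 : ℝ) from hs')]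
        rw [← ENNReal.ofReal_mul (by positivity), ← ENNReal.ofReal_mul (by positivity)]
        refine le_of_eq (congrArg _ ?_)
        rw [show -s = y + -(s + y) by ring, Real.exp_add]
        ring
    _ ≤ ∫⁻ s, ENNReal.ofReal (Real.exp y / n.factorial) * G (s + y) := setLIntegral_le_lintegral _ _
    _ = ENNReal.ofReal (Real.exp y / n.factorial) * ∫⁻ s, G s := by
        rw [lintegral_const_mul _ (by fun_prop), lintegral_add_right_eq_self]
    _ = ENNReal.ofReal (Real.exp y) := by
        rw [lintegral_indicator measurableSet_Ioi, ← ofReal_integral_eq_lintegral_ofReal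
          (integrableOn_pow_mul_exp_neg n), integral_pow_mul_exp_neg,
          ← ENNReal.ofReal_mul (by positivity), div_mul_cancel₀ _ hfac.ne']
        filter_upwards [ae_restrict_mem measurableSet_Ioi] with s hs
        exact mul_nonneg (Real.exp_nonneg _) (pow_nonneg (le_of_lt hs) _)

/-! ### The permanent bound `∏ (1 - l)⁻¹`. -/

theorem prod_le_sum_div_card_pow {n : ℕ} (hn : 1 ≤ n) (x : Fin n → ℝ) (hx : ∀ i, 0 ≤ x i) :
    ∏ i, x i ≤ ((∑ i, x i) / n) ^ n := by
  have hn' : (n : ℝ) ≠ 0 := by positivity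
  have h := Real.geom_mean_le_arith_mean_weighted Finset.univ (fun _ : Fin n => (n : ℝ)⁻¹) x
    (fun _ _ => by positivity) (by simp [hn']) (fun i _ => hx i)
  have h2 := pow_le_pow_left₀ (Finset.prod_nonneg fun i _ => Real.rpow_nonneg (hx i) _) h n
  rw [← Finset.prod_pow, ← Finset.mul_sum] at h2
  have h3 : ∀ i, (x i ^ (n : ℝ)⁻¹) ^ n = x i := fun i => Real.rpow_inv_natCast_pow (hx i) (by omega)
  simp_rw [h3] at h2
  rwa [div_eq_inv_mul]

theorem sum_normSq_linearForms {α κ : Type*} [Fintype α] [Fintype κ] [DecidableEq κ]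
    (v : α → κ → ℝ) (c : κ → ℝ) (hv : ∀ a b, ∑ i, v i a * v i b = if a = b then c a else 0)
    (z : κ → ℂ) :
    ∑ i, ‖∑ a, (v i a : ℂ) * z a‖ ^ 2 = ∑ a, c a * ‖z a‖ ^ 2 := by
  apply Complex.ofReal_injective
  push_cast
  simp_rw [← Complex.mul_conj', map_sum, map_mul, Complex.conj_ofReal, Finset.sum_mul_sum]
  rw [Finset.sum_comm]
  refine Finset.sum_congr rfl fun a _ => ?_
  rw [Finset.sum_comm]
  have : ∀ b, ∑ i, (v i a : ℂ) * z a * ((v i b : ℂ) * starRingEnd ℂ (z b)) =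
      if a = b then (c a : ℂ) * (z a * starRingEnd ℂ (z b)) else 0 := by
    intro b
    have h := congrArg (Complex.ofReal) (hv a b)
    push_cast at h
    calc _ = (∑ i, (v i a : ℂ) * v i b) * (z a * starRingEnd ℂ (z b)) := by
          rw [Finset.sum_mul]; exact Finset.sum_congr rfl fun i _ => by ring
      _ = _ := by rw [h]; split_ifs <;> simp
  simp_rw [this]
  simp

theorem lintegral_pi_prod {ι : Type*} [Fintype ι] {Ω : Type*} [MeasurableSpace Ω] (ρ : Measure Ω)
    [IsProbabilityMeasure ρ] (f : ι → Ω → ℝ≥0∞) (hf : ∀ i, Measurable (f i)) :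
    ∫⁻ ω : ι → Ω, ∏ i, f i (ω i) ∂(Measure.pi fun _ => ρ) = ∏ i, ∫⁻ x, f i x ∂ρ := by
  rw [lintegral_prod_eq_prod_lintegral_of_indepFun Finset.univ (fun i (ω : ι → Ω) => f i (ω i))
    (iIndepFun_pi fun i => (hf i).aemeasurable) (fun i => (hf i).comp (measurable_pi_apply i))]
  refine Finset.prod_congr rfl fun i _ => ?_
  exact (measurePreserving_eval (fun _ : ι => ρ) i).lintegral_comp (hf i)

/-- The average over two independent uniform permutations `π, π'` of `∏ᵢ (1 + M (π i) (π' i))`. -/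
noncomputable def permMean {n : ℕ} (M : Fin n → Fin n → ℝ) : ℝ :=
  ((n.factorial : ℝ) ^ 2)⁻¹ *
    ∑ π : Equiv.Perm (Fin n), ∑ π' : Equiv.Perm (Fin n), ∏ i, (1 + M (π i) (π' i))

/-- Only the relative permutation `π' π⁻¹` matters, so the double average is a normalized permanent.
-/
theorem permMean_eq {n : ℕ} (M : Fin n → Fin n → ℝ) :
    permMean M = (n.factorial : ℝ)⁻¹ * ∑ σ : Equiv.Perm (Fin n), ∏ i, (1 + M i (σ i)) := by
  have h : ∀ π : Equiv.Perm (Fin n), ∑ π' : Equiv.Perm (Fin n), ∏ i, (1 + M (π i) (π' i)) =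
      ∑ σ : Equiv.Perm (Fin n), ∏ i, (1 + M i (σ i)) := by
    intro π
    rw [← Equiv.sum_comp (Equiv.mulRight π)]
    refine Finset.sum_congr rfl fun σ _ => ?_
    exact Equiv.prod_comp π (fun j => 1 + M j (σ j))
  have hfac : (n.factorial : ℝ) ≠ 0 := by positivity
  rw [permMean]
  simp_rw [h]
  rw [Finset.sum_const, Finset.card_univ, Fintype.card_perm, Fintype.card_fin, nsmul_eq_mul]
  field_simp

/-- Coordinate 0 is integrated first; it trades the `n`-th power for an exponential, which
factorizes over the other coordinates. -/
theorem lintegral_weighted_normSq_pow_le {m : ℕ} (n : ℕ) (l : Fin m → ℝ)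
    (hl : ∀ a, 0 ≤ l a) (hl1 : ∀ a, l a < 1) :
    ∫⁻ ω : Fin (m + 1) → ℝ × ℝ, ENNReal.ofReal ((‖sqrtPolar (ω 0)‖ ^ 2 +
        ∑ a, l a * ‖sqrtPolar (ω (Fin.succ a))‖ ^ 2) ^ n / n.factorial)
        ∂(Measure.pi fun _ => polarGaussian) ≤ ENNReal.ofReal (∏ a, (1 - l a)⁻¹) := by
  have hm := measurable_sqrtPolar
  let Y : (Fin m → ℝ × ℝ) → ℝ := fun ω => ∑ a, l a * ‖sqrtPolar (ω a)‖ ^ 2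
  have hY : Measurable Y := by fun_prop
  have hY0 : ∀ ω, 0 ≤ Y ω := fun ω => Finset.sum_nonneg fun a _ => mul_nonneg (hl a) (sq_nonneg _)
  have hYexp : ∀ ω, ENNReal.ofReal (Real.exp (Y ω)) =
      ∏ a, ENNReal.ofReal (Real.exp (l a * ‖sqrtPolar (ω a)‖ ^ 2)) := fun ω => by
    rw [Real.exp_sum, ENNReal.ofReal_prod_of_nonneg fun _ _ => Real.exp_nonneg _]
  let G : (ℝ × ℝ) × (Fin m → ℝ × ℝ) → ℝ≥0∞ := fun p =>
    ENNReal.ofReal ((‖sqrtPolar p.1‖ ^ 2 + Y p.2) ^ n / n.factorial)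
  have hG : Measurable G := by fun_prop
  have hp := (measurePreserving_piFinSuccAbove
    (fun _ : Fin (m + 1) => polarGaussian) 0).lintegral_comp hG
  have hpt : ∀ ω : Fin (m + 1) → ℝ × ℝ, ENNReal.ofReal ((‖sqrtPolar (ω 0)‖ ^ 2 +
        ∑ a, l a * ‖sqrtPolar (ω (Fin.succ a))‖ ^ 2) ^ n / n.factorial) =
      G (MeasurableEquiv.piFinSuccAbove (fun _ => ℝ × ℝ) 0 ω) := fun ω => by
    simp [G, Y, MeasurableEquiv.piFinSuccAbove, Fin.insertNthEquiv, Fin.removeNth_zero, Fin.tail]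
  simp_rw [hpt]
  rw [hp, lintegral_prod_symm _ hG.aemeasurable]
  calc ∫⁻ ω, ∫⁻ p, G (p, ω) ∂polarGaussian ∂(Measure.pi fun _ : Fin m => polarGaussian)
      ≤ ∫⁻ ω, ENNReal.ofReal (Real.exp (Y ω)) ∂(Measure.pi fun _ : Fin m => polarGaussian) :=
        lintegral_mono fun ω => lintegral_add_pow_div_factorial_le (hY0 ω) n
    _ = ∏ a, ENNReal.ofReal (1 - l a)⁻¹ := by
        simp_rw [hYexp]
        rw [lintegral_pi_prod polarGaussian
          (fun a p => ENNReal.ofReal (Real.exp (l a * ‖sqrtPolar p‖ ^ 2))) (fun a => by fun_prop)]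
        exact Finset.prod_congr rfl fun a _ => lintegral_exp_mul_normSq (hl1 a)
    _ = ENNReal.ofReal (∏ a, (1 - l a)⁻¹) := by
        rw [ENNReal.ofReal_prod_of_nonneg fun a _ => inv_nonneg.2 (by linarith [hl1 a])]

/-- Wick's formula followed by AM-GM. The factor `n^n / n!` is absorbed exactly: `n^n` by the mean
in AM-GM, `1/n!` by the exponential coordinate. -/
theorem permMean_gram_le {n m : ℕ} (hn : 1 ≤ n) (w : Fin n → Fin m → ℝ) (l : Fin m → ℝ)
    (hl : ∀ a, 0 ≤ l a) (hl1 : ∀ a, l a < 1)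
    (hw : ∀ a b, ∑ i, w i a * w i b = if a = b then l a else 0) (hw0 : ∀ a, ∑ i, w i a = 0) :
    permMean (fun i j => n * ∑ a, w i a * w j a) ≤ ∏ a, (1 - l a)⁻¹ := by
  have hn' : (0 : ℝ) < n := by exact_mod_cast hn
  have hsq : (√(n : ℝ))⁻¹ * (√(n : ℝ))⁻¹ = (n : ℝ)⁻¹ := by
    rw [← mul_inv, Real.mul_self_sqrt hn'.le]
  -- A unit constant column accounts for the `1` in `1 + M`: `n ∑ₐ v i a v j a = 1 + n ∑ₐ w i a w j
  -- a`. It is orthogonal to the other columns because these sum to zero.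
  let v : Fin n → Fin (m + 1) → ℝ := fun i => Fin.cons (√(n : ℝ))⁻¹ (w i)
  let c : Fin (m + 1) → ℝ := Fin.cons 1 l
  have hv : ∀ a b, ∑ i, v i a * v i b = if a = b then c a else 0 := by
    intro a b
    refine Fin.cases ?_ (fun a => ?_) a <;> refine Fin.cases ?_ (fun b => ?_) b
    · simp [v, c, hsq, hn'.ne']
    · simp [v, ← Finset.mul_sum, hw0, (Fin.succ_ne_zero b).symm]
    · simp [v, ← Finset.sum_mul, hw0]
    · simp [v, c, hw]
  have hprod0 : (0 : ℝ) ≤ ∏ a, (1 - l a)⁻¹ :=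
    Finset.prod_nonneg fun a _ => inv_nonneg.2 (by linarith [hl1 a])
  have hterm : ∀ σ : Equiv.Perm (Fin n), ∏ i, (1 + n * ∑ a, w i a * w (σ i) a) =
      (n : ℝ) ^ n * ∏ i, ∑ a, v i a * v (σ i) a := fun σ => by
    have h : (n : ℝ) ^ n = ∏ _i : Fin n, (n : ℝ) := by simp
    rw [h, ← Finset.prod_mul_distrib]
    refine Finset.prod_congr rfl fun i _ => ?_
    simp only [v, Fin.sum_univ_succ, Fin.cons_zero, Fin.cons_succ, hsq]
    field_simp
  have key : permMean (fun i j => n * ∑ a, w i a * w j a) =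
      ∫ ω : Fin (m + 1) → ℝ × ℝ, ((n : ℝ) ^ n / n.factorial) *
        ∏ i, ‖∑ a, (v i a : ℂ) * sqrtPolar (ω a)‖ ^ 2 ∂(Measure.pi fun _ => polarGaussian) := by
    rw [integral_const_mul, isComplexGaussian_sqrtPolar.integral_prod, permMean_eq]
    simp_rw [hterm]
    rw [← Finset.mul_sum]
    ring
  rw [← ENNReal.ofReal_le_ofReal_iff hprod0, key, ofReal_integral_eq_lintegral_ofReal
    ((isComplexGaussian_sqrtPolar.integrable_prod v).const_mul _)
    (Filter.Eventually.of_forall fun ω => mul_nonneg (by positivity)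
      (Finset.prod_nonneg fun i _ => by positivity))]
  refine (lintegral_mono fun ω => ENNReal.ofReal_le_ofReal ?_).trans
    (lintegral_weighted_normSq_pow_le n l hl hl1)
  have h1 := prod_le_sum_div_card_pow hn
    (fun i => ‖∑ a, (v i a : ℂ) * sqrtPolar (ω a)‖ ^ 2) (fun i => by positivity)
  rw [sum_normSq_linearForms v c hv] at h1
  have h2 : ∑ a, c a * ‖sqrtPolar (ω a)‖ ^ 2 =
      ‖sqrtPolar (ω 0)‖ ^ 2 + ∑ a, l a * ‖sqrtPolar (ω (Fin.succ a))‖ ^ 2 := by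
    simp [Fin.sum_univ_succ, c]
  rw [h2] at h1
  calc _ ≤ ((n : ℝ) ^ n / n.factorial) * ((‖sqrtPolar (ω 0)‖ ^ 2 +
        ∑ a, l a * ‖sqrtPolar (ω (Fin.succ a))‖ ^ 2) / n) ^ n := by gcongr
    _ = _ := by
      rw [div_pow]; field_simp

/-! ### Orthogonal Gram factors and scaling of the matrix. -/

theorem Matrix.PosSemidef.exists_orthogonal_gram {n : ℕ} {B : Matrix (Fin n) (Fin n) ℝ}
    (hB : B.PosSemidef) : ∃ (w : Fin n → Fin n → ℝ) (l : Fin n → ℝ), (∀ a, 0 ≤ l a) ∧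
      (∀ i j, B i j = ∑ a, w i a * w j a) ∧
      ∀ a b, ∑ i, w i a * w i b = if a = b then l a else 0 := by
  have hl := hB.eigenvalues_nonneg
  refine ⟨fun i a => √(hB.1.eigenvalues a) * (hB.1.eigenvectorUnitary : Matrix (Fin n) (Fin n) ℝ) i a,
    hB.1.eigenvalues, hl, fun i j => ?_, fun a b => ?_⟩
  · conv_lhs => rw [hB.1.spectral_theorem]
    rw [Unitary.conjStarAlgAut_apply, Matrix.mul_apply]
    refine Finset.sum_congr rfl fun a _ => ?_
    rw [Matrix.mul_diagonal, Matrix.star_apply]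
    simp only [Function.comp, RCLike.ofReal_real_eq_id, id, star_trivial]
    have := Real.mul_self_sqrt (hl a)
    linear_combination (-(hB.1.eigenvectorUnitary : Matrix (Fin n) (Fin n) ℝ) i a *
      (hB.1.eigenvectorUnitary : Matrix (Fin n) (Fin n) ℝ) j a) * this
  · have h := congrFun (congrFun (Unitary.coe_star_mul_self hB.1.eigenvectorUnitary) a) b
    rw [Matrix.mul_apply, Matrix.one_apply] at h
    simp only [Matrix.star_apply, star_trivial] at h
    calc _ = √(hB.1.eigenvalues a) * √(hB.1.eigenvalues b) *
          ∑ i, (hB.1.eigenvectorUnitary : Matrix (Fin n) (Fin n) ℝ) i a *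
            (hB.1.eigenvectorUnitary : Matrix (Fin n) (Fin n) ℝ) i b := by
          rw [Finset.mul_sum]; exact Finset.sum_congr rfl fun i _ => by ring
      _ = _ := by
          rw [h]
          split_ifs with hab
          · rw [hab, mul_one, Real.mul_self_sqrt (hl b)]
          · rw [mul_zero]

theorem permMean_smul_eq_sum {n : ℕ} (M : Fin n → Fin n → ℝ) (t : ℝ) :
    permMean (fun i j => t * M i j) = ∑ S : Finset (Fin n), t ^ S.card *
      (((n.factorial : ℝ) ^ 2)⁻¹ * ∑ π : Equiv.Perm (Fin n), ∑ π' : Equiv.Perm (Fin n),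
        ∏ i ∈ S, M (π i) (π' i)) := by
  rw [permMean]
  simp_rw [Finset.prod_one_add, Finset.powerset_univ, Finset.prod_mul_distrib, Finset.prod_const,
    Finset.mul_sum]
  symm
  rw [Finset.sum_comm]
  refine Finset.sum_congr rfl fun π _ => ?_
  rw [Finset.sum_comm]
  exact Finset.sum_congr rfl fun π' _ => Finset.sum_congr rfl fun S _ => by ring

/-- Composing with a cyclic shift does not change the sum, and averaging over all shifts replaces `f
(σ i)` by the mean of `f`. -/
theorem sum_perm_apply_eq_zero {n : ℕ} (f : Fin n → ℝ) (hf : ∑ j, f j = 0) (i : Fin n) :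
    ∑ σ : Equiv.Perm (Fin n), f (σ i) = 0 := by
  have : NeZero n := ⟨by have := i.2; omega⟩
  have h : ∀ k : Fin n, ∑ σ : Equiv.Perm (Fin n), f (σ i + k) =
      ∑ σ : Equiv.Perm (Fin n), f (σ i) := fun k =>
    Equiv.sum_comp (Equiv.mulLeft (Equiv.addRight k)) (fun σ : Equiv.Perm (Fin n) => f (σ i))
  have h2 : ∑ k : Fin n, ∑ σ : Equiv.Perm (Fin n), f (σ i + k) = 0 := by
    rw [Finset.sum_comm]
    refine Finset.sum_eq_zero fun σ _ => ?_
    rw [← hf]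
    exact Equiv.sum_comp (Equiv.addLeft (σ i)) f
  simp_rw [h, Finset.sum_const, Finset.card_univ, Fintype.card_fin, nsmul_eq_mul] at h2
  exact (mul_eq_zero.1 h2).resolve_left (by exact_mod_cast NeZero.ne n)

/-- Expanding the inner products separates `π` from `π'`, leaving a sum of squares. These are the
coefficients of the polynomial in `t`. -/
theorem sum_perm_prod_gram_nonneg {n m : ℕ} (w : Fin n → Fin m → ℝ) (S : Finset (Fin n)) :
    0 ≤ ∑ π : Equiv.Perm (Fin n), ∑ π' : Equiv.Perm (Fin n),
      ∏ i ∈ S, ∑ a, w (π i) a * w (π' i) a := by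
  have h : ∀ π π' : Equiv.Perm (Fin n), ∏ i ∈ S, ∑ a, w (π i) a * w (π' i) a =
      ∑ f ∈ Fintype.piFinset fun _ : S => (Finset.univ : Finset (Fin m)),
        (∏ i : S, w (π i) (f i)) * ∏ i : S, w (π' i) (f i) := by
    intro π π'
    rw [← Finset.prod_coe_sort, Finset.prod_univ_sum]
    simp_rw [Finset.prod_mul_distrib]
  simp_rw [h]
  have h2 : ∀ π : Equiv.Perm (Fin n), ∑ π' : Equiv.Perm (Fin n),
      ∑ f ∈ Fintype.piFinset fun _ : S => (Finset.univ : Finset (Fin m)),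
        (∏ i : S, w (π i) (f i)) * ∏ i : S, w (π' i) (f i) =
      ∑ f ∈ Fintype.piFinset fun _ : S => (Finset.univ : Finset (Fin m)),
        (∏ i : S, w (π i) (f i)) * ∑ π' : Equiv.Perm (Fin n), ∏ i : S, w (π' i) (f i) := by
    intro π
    rw [Finset.sum_comm]
    simp_rw [Finset.mul_sum]
  simp_rw [h2]
  rw [Finset.sum_comm]
  refine Finset.sum_nonneg fun f _ => ?_
  rw [← Finset.sum_mul]
  exact mul_self_nonneg _

/-- The polynomial in `t` has constant term 1, no linear term since row sums vanish, and nonnegative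
higher coefficients, for which `t^k ≥ t²` when `k ≥ 2`. -/
theorem sq_mul_permMean_sub_one_le {n m : ℕ} (w : Fin n → Fin m → ℝ)
    (hw0 : ∀ i, ∑ j, ∑ a, w i a * w j a = 0) {t : ℝ} (ht : 1 ≤ t) :
    t ^ 2 * (permMean (fun i j => ∑ a, w i a * w j a) - 1) ≤
      permMean (fun i j => t * ∑ a, w i a * w j a) - 1 := by
  have h1 := permMean_smul_eq_sum (fun i j => ∑ a, w i a * w j a) 1
  have h2 := permMean_smul_eq_sum (fun i j => ∑ a, w i a * w j a) t
  simp only [one_mul, one_pow] at h1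
  rw [h1, h2]
  have hterm : ∀ S : Finset (Fin n), (if S = ∅ then 1 - t ^ 2 else 0) ≤
      (t ^ S.card - t ^ 2) * (((n.factorial : ℝ) ^ 2)⁻¹ * ∑ π : Equiv.Perm (Fin n),
        ∑ π' : Equiv.Perm (Fin n), ∏ i ∈ S, ∑ a, w (π i) a * w (π' i) a) := by
    intro S
    rcases Nat.lt_or_ge S.card 2 with hS | hS
    · rcases Nat.lt_or_ge S.card 1 with hS0 | hS1
      · obtain rfl : S = ∅ := by rw [← Finset.card_eq_zero]; omega
        have hfac : (n.factorial : ℝ) ≠ 0 := by positivity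
        simp only [if_true, Finset.card_empty, pow_zero, Finset.prod_empty, Finset.sum_const,
          Finset.card_univ, Fintype.card_perm, Fintype.card_fin, nsmul_eq_mul, mul_one]
        field_simp
        exact le_rfl
      · obtain ⟨i, rfl⟩ := Finset.card_eq_one.1 (by omega : S.card = 1)
        rw [if_neg (Finset.singleton_ne_empty i)]
        simp only [Finset.prod_singleton]
        simp_rw [sum_perm_apply_eq_zero _ (hw0 _)]
        simp
    · rw [if_neg (by rintro rfl; simp at hS)]
      refine mul_nonneg (sub_nonneg.2 (pow_le_pow_right₀ ht hS)) (mul_nonneg (by positivity)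
        (sum_perm_prod_gram_nonneg w S))
  have hsum := Finset.sum_le_sum fun S (_ : S ∈ Finset.univ) => hterm S
  simp only [Finset.sum_ite_eq', Finset.mem_univ, if_true, sub_mul, Finset.sum_sub_distrib,
    ← Finset.mul_sum] at hsum
  simp only [← Finset.mul_sum] at hsum ⊢
  linarith

/-! ### From the spectrum to bounds in the trace and the smallest entry. -/

theorem prod_inv_one_sub_le {ι : Type*} (s : Finset ι) (x : ι → ℝ) (hx : ∀ a ∈ s, 0 ≤ x a)
    (hs : ∑ a ∈ s, x a < 1) : ∏ a ∈ s, (1 - x a)⁻¹ ≤ (1 - ∑ a ∈ s, x a)⁻¹ := by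
  have h : 1 - ∑ a ∈ s, x a ≤ ∏ a ∈ s, (1 - x a) := by
    have h1 : ∀ a ∈ s, x a ≤ 1 := fun a ha =>
      (Finset.single_le_sum hx ha).trans hs.le
    clear hs
    induction s using Finset.cons_induction with
    | empty => simp
    | cons a s ha ih =>
      simp only [Finset.mem_cons, forall_eq_or_imp] at hx h1
      rw [Finset.sum_cons, Finset.prod_cons]
      have ih' := ih hx.2 h1.2
      have := Finset.sum_nonneg hx.2
      have h3 := mul_le_mul_of_nonneg_left ih' (sub_nonneg.2 h1.1)
      nlinarith [mul_nonneg hx.1 this]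
  rw [Finset.prod_inv_distrib]
  exact inv_anti₀ (by linarith) h

/-- For `x ≤ 1/2` the linear bound `1 + 2x` suffices; for `x ≥ 1/2` the left side is at most `1/δ`,
and `log(1/δ) ≤ 2x log(1/δ)`. Keeping the exponent linear in `x` lets the product depend on the
trace only. -/
theorem inv_one_sub_le_exp {δ x : ℝ} (hδ : 0 < δ) (hx : 0 ≤ x) (hxδ : x ≤ 1 - δ) :
    (1 - x)⁻¹ ≤ Real.exp (x * (2 + 2 * Real.log δ⁻¹)) := by
  have hlog : 0 ≤ Real.log δ⁻¹ := Real.log_nonneg ((one_le_inv₀ hδ).2 (by linarith))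
  have h1 : 0 < 1 - x := by linarith
  rcases le_total x (1 / 2) with h | h
  · have h2 : (1 - x)⁻¹ ≤ 1 + 2 * x := by
      rw [inv_le_iff_one_le_mul₀ h1]
      nlinarith
    calc _ ≤ 1 + 2 * x := h2
      _ ≤ Real.exp (2 * x) := by linarith [Real.add_one_le_exp (2 * x)]
      _ ≤ _ := Real.exp_le_exp.2 (by nlinarith [mul_nonneg hx hlog])
  · calc (1 - x)⁻¹ ≤ δ⁻¹ := inv_anti₀ hδ (by linarith)
      _ = Real.exp (Real.log δ⁻¹) := (Real.exp_log (inv_pos.2 hδ)).symm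
      _ ≤ _ := Real.exp_le_exp.2 (by nlinarith [mul_nonneg (sub_nonneg.2 h) hlog])

/-- The off-constant spectrum `l` of the doubly stochastic matrix with entries `(1 + M i j) / n`. -/
theorem exists_spectrum_permMean_le {n : ℕ} (hn : 1 ≤ n) {M : Matrix (Fin n) (Fin n) ℝ}
    (hM : M.PosSemidef) (hM0 : ∀ i, ∑ j, M i j = 0) :
    ∃ l : Fin n → ℝ, (∀ a, 0 ≤ l a) ∧ ∑ a, l a = (∑ i, M i i) / n ∧
      (∀ t, 0 ≤ t → (∀ a, t * l a < 1) →
        permMean (fun i j => t * M i j) ≤ ∏ a, (1 - t * l a)⁻¹) ∧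
      (∀ t, 1 ≤ t → t ^ 2 * (permMean M - 1) ≤ permMean (fun i j => t * M i j) - 1) ∧
      ∀ δ, (∀ i j, δ ≤ 1 + M i j) → ∀ a, l a ≤ 1 - δ := by
  obtain ⟨u, k, hk, hMu, hu⟩ := hM.exists_orthogonal_gram
  have hn' : (0 : ℝ) < n := by exact_mod_cast hn
  -- The squares of the column sums add up to the sum of all entries of `M`, which is zero.
  have hu0 : ∀ a, ∑ i, u i a = 0 := by
    have h : ∑ a, (∑ i, u i a) ^ 2 = 0 := by
      calc ∑ a, (∑ i, u i a) ^ 2 = ∑ a, ∑ i, ∑ j, u i a * u j a := by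
            simp_rw [sq, Finset.sum_mul_sum]
        _ = ∑ i, ∑ j, M i j := by
            rw [Finset.sum_comm]
            refine Finset.sum_congr rfl fun i _ => ?_
            rw [Finset.sum_comm]
            exact Finset.sum_congr rfl fun j _ => (hMu i j).symm
        _ = 0 := by simp [hM0]
    intro a
    exact pow_eq_zero_iff (two_ne_zero) |>.1
      ((Finset.sum_eq_zero_iff_of_nonneg fun a _ => sq_nonneg _).1 h a (Finset.mem_univ a))
  have hMf : M = fun i j => ∑ a, u i a * u j a := funext fun i => funext fun j => hMu i j
  refine ⟨fun a => k a / n, fun a => div_nonneg (hk a) hn'.le, ?_, ?_, ?_, ?_⟩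
  · rw [← Finset.sum_div]
    congr 1
    simp_rw [hMu]
    rw [Finset.sum_comm]
    exact Finset.sum_congr rfl fun a _ => by rw [hu]; simp
  · intro t ht hl
    have := permMean_gram_le hn (fun i a => √(t / n) * u i a) (fun a => t * (k a / n))
      (fun a => mul_nonneg ht (div_nonneg (hk a) hn'.le)) hl (fun a b => ?_)
      (fun a => by rw [← Finset.mul_sum, hu0, mul_zero])
    · refine le_trans (le_of_eq ?_) this
      congr 1
      funext i j
      have hs : √(t / n) * √(t / n) = t / n := Real.mul_self_sqrt (div_nonneg ht hn'.le)
      have : ∀ a, √(t / n) * u i a * (√(t / n) * u j a) = t / n * (u i a * u j a) := fun a => by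
        linear_combination (u i a * u j a) * hs
      simp_rw [this, ← Finset.mul_sum, ← hMu]
      field_simp
    · have hs : √(t / n) * √(t / n) = t / n := Real.mul_self_sqrt (div_nonneg ht hn'.le)
      have : ∀ i, √(t / n) * u i a * (√(t / n) * u i b) = t / n * (u i a * u i b) := fun i => by
        linear_combination (u i a * u i b) * hs
      simp_rw [this, ← Finset.mul_sum, hu]
      split_ifs <;> ring
  · intro t ht
    rw [hMf]
    exact sq_mul_permMean_sub_one_le u (fun i => by simp_rw [← hMu]; exact hM0 i) ht
  -- Spectral gap by a Dirichlet form: for the column `u` with squared norm `k`, compare `∑ (1 + M i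
  -- j)(u i - u j)² = 2nk - 2k²` with `δ ∑ (u i - u j)² = 2nδk`. If `k = 0`, only `δ ≤ 1` is needed,
  -- which follows from averaging a row.
  · intro δ hδ a
    rcases (hk a).eq_or_lt with h0 | hpos
    · have h1 : ∑ j : Fin n, δ ≤ ∑ j, (1 + M ⟨0, hn⟩ j) := Finset.sum_le_sum fun j _ => hδ _ j
      simp only [Finset.sum_add_distrib, hM0, Finset.sum_const, Finset.card_univ, Fintype.card_fin,
        nsmul_eq_mul, mul_one, add_zero] at h1
      have : δ ≤ 1 := by
        by_contra hc
        push Not at hc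
        nlinarith
      simp only [← h0, zero_div]
      linarith
    · have hsq : ∑ i, u i a ^ 2 = k a := by simp_rw [sq, hu]; simp
      have hquad : ∑ i, ∑ j, M i j * (u i a * u j a) = k a ^ 2 := by
        calc _ = ∑ b, (∑ i, u i b * u i a) * (∑ j, u j b * u j a) := by
              simp_rw [Finset.sum_mul_sum]
              rw [Finset.sum_comm]
              refine Eq.trans ?_ Finset.sum_comm
              rw [Finset.sum_comm]
              refine Finset.sum_congr rfl fun i _ => ?_
              rw [Finset.sum_comm]
              refine Finset.sum_congr rfl fun j _ => ?_
              rw [hMu, Finset.sum_mul]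
              exact Finset.sum_congr rfl fun b _ => by ring
          _ = _ := by simp_rw [hu]; simp [sq]
      have hrow : ∀ i, ∑ j, M i j * u i a ^ 2 = 0 := fun i => by
        rw [← Finset.sum_mul, hM0, zero_mul]
      have hcol : ∑ i, ∑ j, M i j * u j a ^ 2 = 0 := by
        rw [Finset.sum_comm]
        refine Finset.sum_eq_zero fun j _ => ?_
        rw [← Finset.sum_mul]
        have : ∑ i, M i j = ∑ i, M j i := Finset.sum_congr rfl fun i _ => by
          simp_rw [hMu, mul_comm]
        rw [this, hM0, zero_mul]
      have h1 : ∑ i, ∑ j, δ * (u i a - u j a) ^ 2 ≤ ∑ i, ∑ j, (1 + M i j) * (u i a - u j a) ^ 2 :=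
        Finset.sum_le_sum fun i _ => Finset.sum_le_sum fun j _ =>
          mul_le_mul_of_nonneg_right (hδ i j) (sq_nonneg _)
      have hD : ∑ i, ∑ j, (u i a - u j a) ^ 2 = 2 * n * k a := by
        have : ∀ i j, (u i a - u j a) ^ 2 = u i a ^ 2 + u j a ^ 2 - 2 * (u i a * u j a) :=
          fun i j => by ring
        simp only [this, Finset.sum_sub_distrib, Finset.sum_add_distrib, ← Finset.mul_sum, hu0,
          mul_zero, hsq, Finset.sum_const, Finset.card_univ, Fintype.card_fin, nsmul_eq_mul]
        ring
      have hDM : ∑ i, ∑ j, M i j * (u i a - u j a) ^ 2 = - 2 * k a ^ 2 := by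
        have : ∀ i j, M i j * (u i a - u j a) ^ 2 =
            M i j * u i a ^ 2 + M i j * u j a ^ 2 - 2 * (M i j * (u i a * u j a)) :=
          fun i j => by ring
        calc _ = ∑ i, ∑ j, M i j * u i a ^ 2 + ∑ i, ∑ j, M i j * u j a ^ 2 -
              2 * ∑ i, ∑ j, M i j * (u i a * u j a) := by
              simp only [this, Finset.sum_sub_distrib, Finset.sum_add_distrib, Finset.mul_sum]
          _ = _ := by rw [hcol, hquad]; simp [hrow]
      simp_rw [add_mul, one_mul, Finset.sum_add_distrib, ← Finset.mul_sum, hD, hDM] at h1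
      rw [div_le_iff₀ hn']
      nlinarith

theorem permMean_le_inv_one_sub {n : ℕ} (hn : 1 ≤ n) {M : Matrix (Fin n) (Fin n) ℝ}
    (hM : M.PosSemidef) (hM0 : ∀ i, ∑ j, M i j = 0) {τ : ℝ} (hτ : (∑ i, M i i) / n ≤ τ)
    (hτ1 : τ < 1) : permMean M ≤ (1 - τ)⁻¹ := by
  obtain ⟨l, hl, hsum, hle, -, -⟩ := exists_spectrum_permMean_le hn hM hM0
  have hl1 : ∀ a, l a < 1 := fun a =>
    (Finset.single_le_sum (fun a _ => hl a) (Finset.mem_univ a)).trans_lt (by linarith)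
  have h := hle 1 zero_le_one (by simpa using hl1)
  simp only [one_mul] at h
  refine h.trans ((prod_inv_one_sub_le _ _ (fun a _ => hl a) (by linarith)).trans ?_)
  exact inv_anti₀ (by linarith) (by linarith)

/-- As long as the scaled trace `t s` is at most `1/2`, the permanent mean of `tM` is at most 2;
quadratic growth then bounds the excess of `M` by `1/t²`. -/
theorem permMean_sub_one_le_sq {n : ℕ} (hn : 1 ≤ n) {M : Matrix (Fin n) (Fin n) ℝ}
    (hM : M.PosSemidef) (hM0 : ∀ i, ∑ j, M i j = 0) {τ : ℝ} (hτ : (∑ i, M i i) / n ≤ τ)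
    (hτ1 : τ ≤ 1 / 2) : permMean M - 1 ≤ 4 * τ ^ 2 := by
  obtain ⟨l, hl, hsum, hle, hscale, -⟩ := exists_spectrum_permMean_le hn hM hM0
  set s := ∑ a, l a with hs
  have hs0 : 0 ≤ s := Finset.sum_nonneg fun a _ => hl a
  have key : ∀ t, 1 ≤ t → t * s ≤ 1 / 2 → t ^ 2 * (permMean M - 1) ≤ 1 := by
    intro t ht hts
    have ht0 : 0 ≤ t := zero_le_one.trans ht
    have hts' : ∑ a, t * l a ≤ 1 / 2 := by rwa [← Finset.mul_sum]
    have h1 := hle t ht0 fun a => (Finset.single_le_sum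
      (fun a _ => mul_nonneg ht0 (hl a)) (Finset.mem_univ a)).trans_lt (by linarith)
    have h2 := prod_inv_one_sub_le Finset.univ (fun a => t * l a)
      (fun a _ => mul_nonneg ht0 (hl a)) (by linarith)
    have h3 : (1 - ∑ a, t * l a)⁻¹ ≤ (1 / 2)⁻¹ := inv_anti₀ (by norm_num) (by linarith)
    have := hscale t ht
    norm_num at h3
    linarith
  -- With zero trace every `t ≥ 1` is admissible; `t = 1 + 1/x`, where `x` is the supposed positive
  -- excess, already gives `t² x > 1`.
  rcases hs0.eq_or_lt with h0 | hpos
  · have : permMean M - 1 ≤ 0 := by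
      by_contra hc
      push Not at hc
      have h1 := key (1 + (permMean M - 1)⁻¹) (by linarith [inv_pos.2 hc]) (by rw [← h0]; norm_num)
      have h2 : (1 + (permMean M - 1)⁻¹) ^ 2 * (permMean M - 1) =
          (permMean M - 1) + 2 + (permMean M - 1)⁻¹ := by field_simp; ring
      linarith [inv_pos.2 hc]
    nlinarith [sq_nonneg τ]
  -- The largest admissible scaling.
  · have h1 := key (2 * s)⁻¹ ((one_le_inv₀ (by linarith)).2 (by linarith))
      (le_of_eq (by field_simp))
    have h2 : permMean M - 1 ≤ (2 * s) ^ 2 := by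
      rw [inv_pow, inv_mul_le_iff₀ (by positivity)] at h1
      linarith
    nlinarith

theorem permMean_le_exp {n : ℕ} (hn : 1 ≤ n) {M : Matrix (Fin n) (Fin n) ℝ}
    (hM : M.PosSemidef) (hM0 : ∀ i, ∑ j, M i j = 0) {τ δ : ℝ} (hτ : (∑ i, M i i) / n ≤ τ)
    (hδ : 0 < δ) (hδM : ∀ i j, δ ≤ 1 + M i j) :
    permMean M ≤ Real.exp (τ * (2 + 2 * Real.log δ⁻¹)) := by
  obtain ⟨l, hl, hsum, hle, -, hgap⟩ := exists_spectrum_permMean_le hn hM hM0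
  have hgap' := hgap δ hδM
  have h := hle 1 zero_le_one fun a => by linarith [hgap' a]
  simp only [one_mul] at h
  have hδ1 : δ ≤ 1 := by linarith [hgap' ⟨0, hn⟩, hl ⟨0, hn⟩]
  have hlog : 0 ≤ Real.log δ⁻¹ := Real.log_nonneg ((one_le_inv₀ hδ).2 hδ1)
  calc permMean M ≤ ∏ a, (1 - l a)⁻¹ := h
    _ ≤ ∏ a, Real.exp (l a * (2 + 2 * Real.log δ⁻¹)) :=
        Finset.prod_le_prod (fun a _ => inv_nonneg.2 (by linarith [hgap' a]))
          fun a _ => inv_one_sub_le_exp hδ (hl a) (hgap' a)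
    _ = Real.exp ((∑ a, l a) * (2 + 2 * Real.log δ⁻¹)) := by rw [← Real.exp_sum, Finset.sum_mul]
    _ ≤ _ := Real.exp_le_exp.2 (mul_le_mul_of_nonneg_right (by linarith) (by linarith))

/-! ### The `χ²` divergence of the permutation mixture as a permanent. -/

theorem pi_withDensity_eq {ι : Type*} [Fintype ι] {X : Type*} [MeasurableSpace X] (Q : Measure X)
    [IsProbabilityMeasure Q] (f : ι → X → ℝ≥0∞) (hf : ∀ i, Measurable (f i))
    [∀ i, SigmaFinite (Q.withDensity (f i))] :
    Measure.pi (fun i => Q.withDensity (f i)) =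
      (Measure.pi fun _ : ι => Q).withDensity fun x => ∏ i, f i (x i) := by
  refine Measure.pi_eq fun s hs => ?_
  rw [withDensity_apply _ (MeasurableSet.univ_pi hs), ← lintegral_indicator (MeasurableSet.univ_pi hs)]
  have h : ∀ x : ι → X, (Set.univ.pi s).indicator (fun x => ∏ i, f i (x i)) x =
      ∏ i, (s i).indicator (f i) (x i) := by
    intro x
    by_cases hx : x ∈ Set.univ.pi s
    · rw [Set.indicator_of_mem hx]
      exact Finset.prod_congr rfl fun i _ => (Set.indicator_of_mem (hx i (Set.mem_univ i)) _).symm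
    · rw [Set.indicator_of_notMem hx]
      simp only [Set.mem_pi, Set.mem_univ, true_imp_iff, not_forall] at hx
      obtain ⟨i, hi⟩ := hx
      exact (Finset.prod_eq_zero (Finset.mem_univ i) (Set.indicator_of_notMem hi _)).symm
  simp_rw [h]
  rw [lintegral_pi_prod Q (fun i => (s i).indicator (f i)) fun i => (hf i).indicator (hs i)]
  refine Finset.prod_congr rfl fun i _ => ?_
  rw [lintegral_indicator (hs i), withDensity_apply _ (hs i)]

section BoundedDensities
variable {X : Type*} [MeasurableSpace X] {Q : Measure X} [IsProbabilityMeasure Q] {n : ℕ}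
  {f : Fin n → X → ℝ} {K : ℝ}

/-- The matrix of `L²(Q)` inner products of the centered densities `f i - 1`. -/
noncomputable def overlapMatrix (Q : Measure X) (f : Fin n → X → ℝ) : Matrix (Fin n) (Fin n) ℝ :=
  fun i j => ∫ x, f i x * f j x ∂Q - 1

theorem one_add_overlapMatrix (Q : Measure X) (f : Fin n → X → ℝ) (i j : Fin n) :
    1 + overlapMatrix Q f i j = ∫ x, f i x * f j x ∂Q := add_sub_cancel _ _

theorem integrable_of_measurable_of_le {g : X → ℝ} (hg : Measurable g) {K : ℝ}
    (h0 : ∀ x, 0 ≤ g x) (hK : ∀ x, g x ≤ K) : Integrable g Q :=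
  Integrable.of_bound hg.aestronglyMeasurable K
    (Filter.Eventually.of_forall fun x => by rw [Real.norm_of_nonneg (h0 x)]; exact hK x)

theorem integrable_mul_of_bounded (hf : ∀ i, Measurable (f i)) (h0 : ∀ i x, 0 ≤ f i x)
    (hK : ∀ i x, f i x ≤ K) (i j : Fin n) : Integrable (fun x => f i x * f j x) Q :=
  integrable_of_measurable_of_le ((hf i).mul (hf j)) (fun x => mul_nonneg (h0 i x) (h0 j x))
    (K := K * K) fun x => mul_le_mul (hK i x) (hK j x) (h0 j x) ((h0 i x).trans (hK i x))

theorem posSemidef_overlapMatrix (hf : ∀ i, Measurable (f i)) (h0 : ∀ i x, 0 ≤ f i x)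
    (hK : ∀ i x, f i x ≤ K) (h1 : ∀ i, ∫ x, f i x ∂Q = 1) : (overlapMatrix Q f).PosSemidef := by
  have hi := integrable_mul_of_bounded (Q := Q) hf h0 hK
  have hint : ∀ i, Integrable (f i) Q := fun i => integrable_of_measurable_of_le (hf i) (h0 i) (hK i)
  refine Matrix.PosSemidef.of_dotProduct_mulVec_nonneg ?_ fun x => ?_
  · ext i j
    simp [overlapMatrix, mul_comm]
  · have h2 : ∀ i j, overlapMatrix Q f i j = ∫ y, (f i y - 1) * (f j y - 1) ∂Q := by
      intro i j
      have : ∀ y, (f i y - 1) * (f j y - 1) = f i y * f j y - f i y - f j y + 1 := fun y => by ring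
      simp_rw [this]
      have hA : Integrable (fun y => f i y * f j y - f i y) Q := (hi i j).sub (hint i)
      have hB : Integrable (fun y => f i y * f j y - f i y - f j y) Q := hA.sub (hint j)
      rw [integral_add hB (integrable_const _), integral_sub hA (hint j), integral_sub (hi i j) (hint i), h1, h1]
      simp [overlapMatrix]
    have hi2 : ∀ i j, Integrable (fun y => x i * x j * ((f i y - 1) * (f j y - 1))) Q := by
      intro i j
      refine Integrable.const_mul ?_ _
      have : ∀ y, (f i y - 1) * (f j y - 1) = f i y * f j y - f i y - f j y + 1 := fun y => by ring
      simp_rw [this]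
      exact (((hi i j).sub (hint i)).sub (hint j)).add (integrable_const _)
    have h3 : star x ⬝ᵥ (overlapMatrix Q f).mulVec x =
        ∫ y, (∑ i, x i * (f i y - 1)) ^ 2 ∂Q := by
      have : ∀ y, (∑ i, x i * (f i y - 1)) ^ 2 =
          ∑ i, ∑ j, x i * x j * ((f i y - 1) * (f j y - 1)) := fun y => by
        rw [sq, Finset.sum_mul_sum]
        exact Finset.sum_congr rfl fun i _ => Finset.sum_congr rfl fun j _ => by ring
      simp_rw [this]
      rw [integral_finsetSum _ fun i _ => integrable_finsetSum _ fun j _ => hi2 i j]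
      simp only [dotProduct, Matrix.mulVec, star_trivial, Finset.mul_sum]
      refine Finset.sum_congr rfl fun i _ => ?_
      rw [integral_finsetSum _ fun j _ => hi2 i j]
      refine Finset.sum_congr rfl fun j _ => ?_
      rw [integral_const_mul, h2]
      ring
    rw [h3]
    exact integral_nonneg fun y => sq_nonneg _

theorem sum_overlapMatrix_eq_zero (hf : ∀ i, Measurable (f i)) (h0 : ∀ i x, 0 ≤ f i x)
    (hK : ∀ i x, f i x ≤ K) (h1 : ∀ i, ∫ x, f i x ∂Q = 1) (hsum : ∀ᵐ x ∂Q, ∑ i, f i x = n)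
    (i : Fin n) : ∑ j, overlapMatrix Q f i j = 0 := by
  have hi := integrable_mul_of_bounded (Q := Q) hf h0 hK
  simp only [overlapMatrix, Finset.sum_sub_distrib]
  rw [← integral_finsetSum _ fun j _ => hi i j]
  have : ∫ x, ∑ j, f i x * f j x ∂Q = ∫ x, f i x * n ∂Q := by
    refine integral_congr_ae ?_
    filter_upwards [hsum] with x hx
    rw [← Finset.mul_sum, hx]
  rw [this, integral_mul_const, h1]
  simp

theorem chiSqDiv_eq_integral {Ω : Type*} [MeasurableSpace Ω] (μ : Measure Ω)
    [IsProbabilityMeasure μ] {L : Ω → ℝ} (hL : Measurable L) (hL0 : ∀ x, 0 ≤ L x)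
    (hLi : Integrable L μ) (hL2 : Integrable (fun x => L x ^ 2) μ) (hL1 : ∫ x, L x ∂μ = 1) :
    chiSqDiv (μ.withDensity fun x => ENNReal.ofReal (L x)) μ =
      ENNReal.ofReal (∫ x, L x ^ 2 ∂μ - 1) := by
  rw [chiSqDiv, if_pos (withDensity_absolutelyContinuous _ _)]
  have h1 : ∫⁻ x, ENNReal.ofReal ((((μ.withDensity fun x => ENNReal.ofReal (L x)).rnDeriv μ
      x).toReal - 1) ^ 2) ∂μ = ∫⁻ x, ENNReal.ofReal ((L x - 1) ^ 2) ∂μ := by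
    refine lintegral_congr_ae ?_
    filter_upwards [Measure.rnDeriv_withDensity μ hL.ennreal_ofReal] with x hx
    rw [hx, ENNReal.toReal_ofReal (hL0 x)]
  have hi : Integrable (fun x => L x ^ 2 - 2 * L x) μ := hL2.sub (hLi.const_mul 2)
  have h2 : ∀ x, (L x - 1) ^ 2 = L x ^ 2 - 2 * L x + 1 := fun x => by ring
  rw [h1, ← ofReal_integral_eq_lintegral_ofReal _ (Filter.Eventually.of_forall fun x => sq_nonneg _)]
  · simp_rw [h2]
    rw [integral_add hi (integrable_const _),
      integral_sub hL2 (hLi.const_mul 2), integral_const_mul, hL1]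
    congr 1
    simp
    ring
  · simp_rw [h2]
    exact hi.add (integrable_const _)

theorem permMixture_withDensity (hf : ∀ i, Measurable (f i)) (h0 : ∀ i x, 0 ≤ f i x) :
    permMixture (fun i => Q.withDensity fun x => ENNReal.ofReal (f i x)) =
      (Measure.pi fun _ : Fin n => Q).withDensity fun x => ENNReal.ofReal
        ((n.factorial : ℝ)⁻¹ * ∑ π : Equiv.Perm (Fin n), ∏ i, f (π i) (x i)) := by
  have hprod : ∀ π : Equiv.Perm (Fin n), ∀ x : Fin n → X, 0 ≤ ∏ i, f (π i) (x i) :=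
    fun π x => Finset.prod_nonneg fun i _ => h0 _ _
  have hd : (fun x : Fin n → X => ENNReal.ofReal
        ((n.factorial : ℝ)⁻¹ * ∑ π : Equiv.Perm (Fin n), ∏ i, f (π i) (x i))) =
      (n.factorial : ℝ≥0∞)⁻¹ • ∑ π : Equiv.Perm (Fin n),
        fun x : Fin n → X => ∏ i, ENNReal.ofReal (f (π i) (x i)) := by
    funext x
    rw [ENNReal.ofReal_mul (by positivity), ENNReal.ofReal_inv_of_pos (by positivity),
      ENNReal.ofReal_natCast, ENNReal.ofReal_sum_of_nonneg fun π _ => hprod π x]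
    simp only [Pi.smul_apply, Finset.sum_apply, smul_eq_mul]
    congr 1
    exact Finset.sum_congr rfl fun π _ => ENNReal.ofReal_prod_of_nonneg fun i _ => h0 _ _
  have hmeas : ∀ π : Equiv.Perm (Fin n), Measurable
      fun x : Fin n → X => ∏ i, ENNReal.ofReal (f (π i) (x i)) := fun π => by fun_prop
  rw [hd, withDensity_smul _ (by fun_prop), permMixture]
  congr 1
  have hs : ∀ s : Finset (Equiv.Perm (Fin n)), (Measure.pi fun _ : Fin n => Q).withDensity
      (∑ π ∈ s, fun x : Fin n → X => ∏ i, ENNReal.ofReal (f (π i) (x i))) =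
      ∑ π ∈ s, (Measure.pi fun _ : Fin n => Q).withDensity
        (fun x : Fin n → X => ∏ i, ENNReal.ofReal (f (π i) (x i))) := by
    intro s
    induction s using Finset.cons_induction with
    | empty => simp
    | cons a s ha ih =>
      rw [Finset.sum_cons, Finset.sum_cons, withDensity_add_left (hmeas a), ih]
  rw [hs]
  refine Finset.sum_congr rfl fun π _ => ?_
  exact pi_withDensity_eq Q (fun i x => ENNReal.ofReal (f (π i) x)) fun i => (hf _).ennreal_ofReal

/-- The squared likelihood ratio is a double average over `π, π'` of products over coordinates, and
each coordinate integrates to an entry of `1 + M`. -/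
theorem chiSqDiv_permMixture_withDensity (hf : ∀ i, Measurable (f i)) (h0 : ∀ i x, 0 ≤ f i x)
    (hK : ∀ i x, f i x ≤ K) (h1 : ∀ i, ∫ x, f i x ∂Q = 1) :
    chiSqDiv (permMixture fun i => Q.withDensity fun x => ENNReal.ofReal (f i x))
      (Measure.pi fun _ : Fin n => Q) = ENNReal.ofReal (permMean (overlapMatrix Q f) - 1) := by
  have hfac : (n.factorial : ℝ) ≠ 0 := by positivity
  have hint : ∀ i, Integrable (f i) Q := fun i => integrable_of_measurable_of_le (hf i) (h0 i) (hK i)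
  have hip : ∀ π : Equiv.Perm (Fin n), Integrable (fun x : Fin n → X => ∏ i, f (π i) (x i))
      (Measure.pi fun _ => Q) := fun π =>
    Integrable.fintype_prod (f := fun i => f (π i)) fun i => hint (π i)
  have hipp : ∀ π π' : Equiv.Perm (Fin n), Integrable (fun x : Fin n → X =>
      ∏ i, (f (π i) (x i) * f (π' i) (x i))) (Measure.pi fun _ => Q) := fun π π' =>
    Integrable.fintype_prod (f := fun i y => f (π i) y * f (π' i) y)
      fun i => integrable_mul_of_bounded hf h0 hK _ _
  have hsq : ∀ x : Fin n → X,
      ((n.factorial : ℝ)⁻¹ * ∑ π : Equiv.Perm (Fin n), ∏ i, f (π i) (x i)) ^ 2 =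
      ((n.factorial : ℝ) ^ 2)⁻¹ * ∑ π : Equiv.Perm (Fin n), ∑ π' : Equiv.Perm (Fin n),
        ∏ i, (f (π i) (x i) * f (π' i) (x i)) := fun x => by
    rw [mul_pow, inv_pow, sq (∑ π : Equiv.Perm (Fin n), _), Finset.sum_mul_sum]
    simp_rw [Finset.prod_mul_distrib]
  rw [permMixture_withDensity hf h0, chiSqDiv_eq_integral]
  · simp_rw [hsq]
    rw [integral_const_mul, integral_finsetSum _ fun π _ => integrable_finsetSum _ fun π' _ =>
      hipp π π']
    unfold permMean
    congr 3
    refine Finset.sum_congr rfl fun π _ => ?_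
    rw [integral_finsetSum _ fun π' _ => hipp π π']
    refine Finset.sum_congr rfl fun π' _ => ?_
    rw [integral_fintype_prod_eq_prod (fun i y => f (π i) y * f (π' i) y)]
    exact Finset.prod_congr rfl fun i _ => (one_add_overlapMatrix _ _ _ _).symm
  · fun_prop
  · exact fun x => mul_nonneg (by positivity)
      (Finset.sum_nonneg fun π _ => Finset.prod_nonneg fun i _ => h0 _ _)
  · exact (integrable_finsetSum _ fun π _ => hip π).const_mul _
  · simp_rw [hsq]
    exact (integrable_finsetSum _ fun π _ => integrable_finsetSum _ fun π' _ =>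
      hipp π π').const_mul _
  · rw [integral_const_mul, integral_finsetSum _ fun π _ => hip π]
    have : ∀ π : Equiv.Perm (Fin n),
        ∫ x : Fin n → X, ∏ i, f (π i) (x i) ∂(Measure.pi fun _ => Q) = 1 := fun π => by
      rw [integral_fintype_prod_eq_prod (fun i => f (π i))]
      simp [h1]
    simp_rw [this]
    simp [Fintype.card_perm, hfac]

end BoundedDensities

/-! ### Trace and affinity criteria for families with densities. -/

/-- The probability measures `P i` have real densities `p i` with respect to `ν`. -/
structure IsDensityFamily {X : Type*} [MeasurableSpace X] (ν : Measure X) {n : ℕ}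
    (p : Fin n → X → ℝ) (P : Fin n → Measure X) : Prop where
  measurable (i : Fin n) : Measurable (p i)
  nonneg (i : Fin n) (x : X) : 0 ≤ p i x
  eq_withDensity (i : Fin n) : P i = ν.withDensity fun x => ENNReal.ofReal (p i x)
  isProbabilityMeasure (i : Fin n) : IsProbabilityMeasure (P i)

namespace IsDensityFamily

variable {X : Type*} [MeasurableSpace X] {ν : Measure X} {n : ℕ} {p : Fin n → X → ℝ}
  {P : Fin n → Measure X}

/-- The density of the averaged measure. -/
noncomputable def avg (p : Fin n → X → ℝ) (x : X) : ℝ := (∑ i, p i x) / n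

/-- The density of `P i` with respect to the averaged measure. -/
noncomputable def ratio (p : Fin n → X → ℝ) (i : Fin n) (x : X) : ℝ := p i x / avg p x

/-- The averaged measure. -/
noncomputable def mix (P : Fin n → Measure X) : Measure X := (n : ℝ≥0∞)⁻¹ • ∑ i, P i

theorem measurable_avg (h : IsDensityFamily ν p P) : Measurable (avg p) := by
  have := h.measurable
  unfold avg; fun_prop

theorem measurable_ratio (h : IsDensityFamily ν p P) (i : Fin n) : Measurable (ratio p i) :=
  (h.measurable i).div h.measurable_avg

theorem avg_nonneg (h : IsDensityFamily ν p P) (x : X) : 0 ≤ avg p x :=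
  div_nonneg (Finset.sum_nonneg fun i _ => h.nonneg i x) (by positivity)

theorem ratio_nonneg (h : IsDensityFamily ν p P) (i : Fin n) (x : X) : 0 ≤ ratio p i x :=
  div_nonneg (h.nonneg i x) (h.avg_nonneg x)

theorem le_mul_avg (h : IsDensityFamily ν p P) (i : Fin n) (x : X) : p i x ≤ n * avg p x := by
  have hn : (n : ℝ) ≠ 0 := Nat.cast_ne_zero.2 (by have := i.2; omega)
  rw [avg, mul_div_cancel₀ _ hn]
  exact Finset.single_le_sum (fun j _ => h.nonneg j x) (Finset.mem_univ i)

/-- Relative to the average, densities are automatically bounded, so no integrability has to be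
assumed of the family. -/
theorem ratio_le (h : IsDensityFamily ν p P) (i : Fin n) (x : X) : ratio p i x ≤ n :=
  div_le_of_le_mul₀ (h.avg_nonneg x) (by positivity) (h.le_mul_avg i x)

theorem avg_mul_ratio (h : IsDensityFamily ν p P) (i : Fin n) (x : X) :
    avg p x * ratio p i x = p i x := by
  -- Where the average vanishes the ratio is 0 by convention, and `p i` vanishes too.
  rcases (h.avg_nonneg x).eq_or_lt with h0 | hpos
  · have h1 := h.le_mul_avg i x
    rw [← h0, mul_zero] at h1
    rw [← h0, zero_mul]
    exact le_antisymm (h.nonneg i x) h1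
  · rw [ratio, mul_div_cancel₀ _ hpos.ne']

theorem sum_ratio {X : Type*} {n : ℕ} {p : Fin n → X → ℝ} (hn : 1 ≤ n) {x : X}
    (hx : avg p x ≠ 0) : ∑ i, ratio p i x = n := by
  have hn' : (n : ℝ) ≠ 0 := by positivity
  simp only [ratio]
  rw [← Finset.sum_div, div_eq_iff hx, avg, mul_div_cancel₀ _ hn']

theorem lintegral_density (h : IsDensityFamily ν p P) (i : Fin n) :
    ∫⁻ x, ENNReal.ofReal (p i x) ∂ν = 1 := by
  have := (h.isProbabilityMeasure i).measure_univ
  rwa [h.eq_withDensity, withDensity_apply _ MeasurableSet.univ, Measure.restrict_univ] at this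

theorem integrable (h : IsDensityFamily ν p P) (i : Fin n) : Integrable (p i) ν := by
  refine ⟨(h.measurable i).aestronglyMeasurable, ?_⟩
  rw [hasFiniteIntegral_iff_ofReal (Filter.Eventually.of_forall (h.nonneg i)), h.lintegral_density]
  exact ENNReal.one_lt_top

theorem integral_density (h : IsDensityFamily ν p P) (i : Fin n) : ∫ x, p i x ∂ν = 1 := by
  rw [integral_eq_lintegral_of_nonneg_ae (Filter.Eventually.of_forall (h.nonneg i))
    (h.measurable i).aestronglyMeasurable, h.lintegral_density, ENNReal.toReal_one]

theorem mix_eq (h : IsDensityFamily ν p P) :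
    mix P = ν.withDensity fun x => ENNReal.ofReal (avg p x) := by
  ext s hs
  rw [mix, withDensity_apply _ hs, Measure.smul_apply, Measure.finsetSum_apply]
  have h1 : ∀ x, ENNReal.ofReal (avg p x) = (n : ℝ≥0∞)⁻¹ * ∑ i, ENNReal.ofReal (p i x) := by
    intro x
    rcases Nat.eq_zero_or_pos n with h0 | hn
    · subst h0; simp [avg]
    · rw [avg, ENNReal.ofReal_div_of_pos (by positivity), ENNReal.ofReal_natCast,
        ENNReal.ofReal_sum_of_nonneg fun i _ => h.nonneg i x, ENNReal.div_eq_inv_mul]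
  have h2 := h.measurable
  simp_rw [h1]
  rw [lintegral_const_mul _ (by fun_prop), lintegral_finsetSum _ (by fun_prop), smul_eq_mul]
  congr 1
  exact Finset.sum_congr rfl fun i _ => by rw [h.eq_withDensity, withDensity_apply _ hs]

theorem isProbabilityMeasure_mix (hn : 1 ≤ n) (h : IsDensityFamily ν p P) :
    IsProbabilityMeasure (mix P) := by
  refine ⟨?_⟩
  have h1 : ∀ i, P i Set.univ = 1 := fun i => (h.isProbabilityMeasure i).measure_univ
  simp only [mix, Measure.smul_apply, Measure.finsetSum_apply, h1, Finset.sum_const,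
    Finset.card_univ, Fintype.card_fin, smul_eq_mul, nsmul_eq_mul, mul_one]
  exact ENNReal.inv_mul_cancel (by exact_mod_cast (by omega : n ≠ 0)) (by simp)

theorem withDensity_ratio (h : IsDensityFamily ν p P) (i : Fin n) :
    (mix P).withDensity (fun x => ENNReal.ofReal (ratio p i x)) = P i := by
  have hq := h.measurable_avg.ennreal_ofReal
  have hf := (h.measurable_ratio i).ennreal_ofReal
  rw [h.mix_eq, ← withDensity_mul _ hq hf, h.eq_withDensity]
  congr 1
  funext x
  rw [Pi.mul_apply, ← ENNReal.ofReal_mul (h.avg_nonneg x), h.avg_mul_ratio]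

theorem integral_mix (h : IsDensityFamily ν p P) (g : X → ℝ) :
    ∫ x, g x ∂(mix P) = ∫ x, avg p x * g x ∂ν := by
  rw [h.mix_eq, integral_withDensity_eq_integral_toReal_smul h.measurable_avg.ennreal_ofReal
    (Filter.Eventually.of_forall fun x => ENNReal.ofReal_lt_top)]
  refine integral_congr_ae (Filter.Eventually.of_forall fun x => ?_)
  simp only [smul_eq_mul, ENNReal.toReal_ofReal (h.avg_nonneg x)]

theorem integral_ratio (h : IsDensityFamily ν p P) (i : Fin n) :
    ∫ x, ratio p i x ∂(mix P) = 1 := by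
  simp_rw [h.integral_mix, h.avg_mul_ratio, h.integral_density]

theorem one_add_overlap (h : IsDensityFamily ν p P) (i j : Fin n) :
    1 + overlapMatrix (mix P) (ratio p) i j = ∫ x, p i x * ratio p j x ∂ν := by
  simp_rw [one_add_overlapMatrix, h.integral_mix, ← mul_assoc, h.avg_mul_ratio]

theorem integrable_mul_ratio (h : IsDensityFamily ν p P) (i j : Fin n) :
    Integrable (fun x => p i x * ratio p j x) ν := by
  refine (h.integrable i).mul_bdd (c := n) (h.measurable_ratio j).aestronglyMeasurable
    (Filter.Eventually.of_forall fun x => ?_)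
  rw [Real.norm_of_nonneg (h.ratio_nonneg j x)]
  exact h.ratio_le j x

theorem ae_avg_ne_zero (h : IsDensityFamily ν p P) : ∀ᵐ x ∂(mix P), avg p x ≠ 0 := by
  rw [h.mix_eq, ae_withDensity_iff h.measurable_avg.ennreal_ofReal]
  refine Filter.Eventually.of_forall fun x hx h0 => hx ?_
  rw [h0, ENNReal.ofReal_zero]

theorem posSemidef_overlap (hn : 1 ≤ n) (h : IsDensityFamily ν p P) :
    (overlapMatrix (mix P) (ratio p)).PosSemidef :=
  have := h.isProbabilityMeasure_mix hn
  posSemidef_overlapMatrix h.measurable_ratio h.ratio_nonneg h.ratio_le h.integral_ratio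

theorem sum_overlap (hn : 1 ≤ n) (h : IsDensityFamily ν p P) (i : Fin n) :
    ∑ j, overlapMatrix (mix P) (ratio p) i j = 0 :=
  have := h.isProbabilityMeasure_mix hn
  sum_overlapMatrix_eq_zero h.measurable_ratio h.ratio_nonneg h.ratio_le h.integral_ratio
    (h.ae_avg_ne_zero.mono fun _ hx => sum_ratio hn hx) i

theorem chiSqDiv_eq (hn : 1 ≤ n) (h : IsDensityFamily ν p P) :
    chiSqDiv (permMixture P) (iidMixture P) =
      ENNReal.ofReal (permMean (overlapMatrix (mix P) (ratio p)) - 1) := by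
  have := h.isProbabilityMeasure_mix hn
  have hP : P = fun i => (mix P).withDensity fun x => ENNReal.ofReal (ratio p i x) :=
    funext fun i => (h.withDensity_ratio i).symm
  rw [← chiSqDiv_permMixture_withDensity h.measurable_ratio h.ratio_nonneg h.ratio_le
    h.integral_ratio, ← hP]
  rfl

/-- Bound one factor of `p_i² / q` by the envelope; the remaining ratios `p_i / q` sum to at most
`n`. The result is dimension free. -/
theorem trace_le_of_envelope (hn : 1 ≤ n) (h : IsDensityFamily ν p P) {e : X → ℝ}
    (he : Integrable e ν) (hp : ∀ i x, p i x ≤ e x) {τ : ℝ} (hτ : ∫ x, e x ∂ν ≤ 1 + τ) :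
    (∑ i, overlapMatrix (mix P) (ratio p) i i) / n ≤ τ := by
  have hn' : (0 : ℝ) < n := by exact_mod_cast hn
  rw [div_le_iff₀ hn']
  have h1 : ∑ i, (1 + overlapMatrix (mix P) (ratio p) i i) ≤ n * (1 + τ) := by
    simp_rw [h.one_add_overlap]
    rw [← integral_finsetSum _ fun i _ => h.integrable_mul_ratio i i]
    calc ∫ x, ∑ i, p i x * ratio p i x ∂ν ≤ ∫ x, n * e x ∂ν := by
          refine integral_mono (integrable_finsetSum _ fun i _ => h.integrable_mul_ratio i i)
            (he.const_mul _) fun x => ?_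
          have he0 : 0 ≤ e x := (h.nonneg ⟨0, hn⟩ x).trans (hp _ x)
          calc ∑ i, p i x * ratio p i x ≤ ∑ i, e x * ratio p i x :=
                Finset.sum_le_sum fun i _ => mul_le_mul_of_nonneg_right (hp i x) (h.ratio_nonneg i x)
            _ = e x * ∑ i, ratio p i x := (Finset.mul_sum _ _ _).symm
            _ ≤ e x * n := by
                refine mul_le_mul_of_nonneg_left ?_ he0
                by_cases hx : avg p x = 0
                · simp [ratio, hx]
                · exact (sum_ratio hn hx).le
            _ = n * e x := mul_comm _ _
      _ = n * ∫ x, e x ∂ν := integral_const_mul _ _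
      _ ≤ _ := mul_le_mul_of_nonneg_left hτ hn'.le
  rw [Finset.sum_add_distrib] at h1
  simp only [Finset.sum_const, Finset.card_univ, Fintype.card_fin, nsmul_eq_mul, mul_one] at h1
  linarith

/-- Convexity of the inverse: `1/q` is at most the mean of the `1/p_j`, so each diagonal entry is at
most an average of pairwise `χ²` divergences. -/
theorem trace_le_of_integral_sq_div (hn : 1 ≤ n) (h : IsDensityFamily ν p P)
    (hpos : ∀ i x, 0 < p i x) {τ : ℝ} (hint : ∀ i j, Integrable (fun x => p i x ^ 2 / p j x) ν)
    (hτ : ∀ i j, ∫ x, p i x ^ 2 / p j x ∂ν ≤ 1 + τ) :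
    (∑ i, overlapMatrix (mix P) (ratio p) i i) / n ≤ τ := by
  have hn' : (0 : ℝ) < n := by exact_mod_cast hn
  rw [div_le_iff₀ hn']
  have hinv : ∀ x, (avg p x)⁻¹ ≤ (∑ j, (p j x)⁻¹) / n := by
    intro x
    have h1 := Finset.sq_sum_div_le_sum_sq_div Finset.univ (fun _ : Fin n => (1 : ℝ))
      (g := fun j => p j x) fun j _ => hpos j x
    simp only [Finset.sum_const, Finset.card_univ, Fintype.card_fin, nsmul_eq_mul, mul_one,
      one_pow, one_div] at h1
    rw [avg, inv_div, le_div_iff₀ hn', ← mul_div_right_comm, ← sq]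
    exact h1
  have h1 : ∀ i, 1 + overlapMatrix (mix P) (ratio p) i i ≤ 1 + τ := by
    intro i
    rw [h.one_add_overlap]
    calc ∫ x, p i x * ratio p i x ∂ν ≤ ∫ x, (∑ j, p i x ^ 2 / p j x) / n ∂ν := by
          refine integral_mono (h.integrable_mul_ratio i i)
            ((integrable_finsetSum _ fun j _ => hint i j).div_const _) fun x => ?_
          calc p i x * ratio p i x = p i x ^ 2 * (avg p x)⁻¹ := by rw [ratio]; ring
            _ ≤ p i x ^ 2 * ((∑ j, (p j x)⁻¹) / n) :=
                mul_le_mul_of_nonneg_left (hinv x) (sq_nonneg _)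
            _ = (∑ j, p i x ^ 2 / p j x) / n := by
                simp_rw [div_eq_mul_inv, ← Finset.mul_sum]; ring
      _ = (∑ j, ∫ x, p i x ^ 2 / p j x ∂ν) / n := by
          rw [integral_div, integral_finsetSum _ fun j _ => hint i j]
      _ ≤ (∑ _j : Fin n, (1 + τ)) / n := by gcongr; exact hτ i _
      _ = 1 + τ := by simp; field_simp
  calc ∑ i, overlapMatrix (mix P) (ratio p) i i ≤ ∑ _i : Fin n, τ :=
        Finset.sum_le_sum fun i _ => by linarith [h1 i]
    _ = τ * n := by simp; ring

/-- Cauchy–Schwarz under the averaged measure, written as nonnegativity of the variance of the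
square root of the product of ratios, whose mean is the Hellinger affinity. -/
theorem sq_le_one_add_overlap (hn : 1 ≤ n) (h : IsDensityFamily ν p P) {i j : Fin n} {r : ℝ}
    (hr : 0 ≤ r) (hij : r ≤ ∫ x, √(p i x * p j x) ∂ν) :
    r ^ 2 ≤ 1 + overlapMatrix (mix P) (ratio p) i j := by
  have := h.isProbabilityMeasure_mix hn
  have hm := h.measurable_ratio
  set b := ∫ x, √(p i x * p j x) ∂ν with hb
  have hb' : ∫ x, √(ratio p i x * ratio p j x) ∂(mix P) = b := by
    rw [h.integral_mix, hb]
    refine integral_congr_ae (Filter.Eventually.of_forall fun x => ?_)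
    simp only
    rw [← h.avg_mul_ratio i, ← h.avg_mul_ratio j, mul_mul_mul_comm,
      Real.sqrt_mul (mul_self_nonneg _), Real.sqrt_mul_self (h.avg_nonneg x)]
  have hi : Integrable (fun x => ratio p i x * ratio p j x) (mix P) :=
    integrable_mul_of_bounded h.measurable_ratio h.ratio_nonneg h.ratio_le i j
  have hsi : Integrable (fun x => √(ratio p i x * ratio p j x)) (mix P) := by
    refine integrable_of_measurable_of_le (by fun_prop) (fun x => Real.sqrt_nonneg _)
      (K := √((n : ℝ) * n)) fun x => Real.sqrt_le_sqrt ?_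
    exact mul_le_mul (h.ratio_le i x) (h.ratio_le j x) (h.ratio_nonneg j x) (by positivity)
  have hnn : 0 ≤ ∫ x, (√(ratio p i x * ratio p j x) - b) ^ 2 ∂(mix P) :=
    integral_nonneg fun x => sq_nonneg _
  have hexp : ∀ x, (√(ratio p i x * ratio p j x) - b) ^ 2 =
      ratio p i x * ratio p j x - 2 * b * √(ratio p i x * ratio p j x) + b ^ 2 := fun x => by
    rw [sub_sq, Real.sq_sqrt (mul_nonneg (h.ratio_nonneg i x) (h.ratio_nonneg j x))]
    ring
  have hd : Integrable (fun x => ratio p i x * ratio p j x -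
      2 * b * √(ratio p i x * ratio p j x)) (mix P) := hi.sub (hsi.const_mul _)
  simp_rw [hexp] at hnn
  rw [integral_add hd (integrable_const _), integral_sub hi (hsi.const_mul _),
    integral_const_mul, hb'] at hnn
  simp only [integral_const, probReal_univ, one_smul] at hnn
  rw [one_add_overlapMatrix]
  nlinarith

theorem chiSqDiv_le_inv_one_sub (hn : 1 ≤ n) (h : IsDensityFamily ν p P) {τ : ℝ}
    (hτ : (∑ i, overlapMatrix (mix P) (ratio p) i i) / n ≤ τ) (hτ1 : τ < 1) :
    chiSqDiv (permMixture P) (iidMixture P) ≤ ENNReal.ofReal (1 - τ)⁻¹ := by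
  rw [h.chiSqDiv_eq hn]
  refine ENNReal.ofReal_le_ofReal ?_
  linarith [permMean_le_inv_one_sub hn (h.posSemidef_overlap hn) (h.sum_overlap hn) hτ hτ1]

theorem chiSqDiv_le_sq (hn : 1 ≤ n) (h : IsDensityFamily ν p P) {τ : ℝ}
    (hτ : (∑ i, overlapMatrix (mix P) (ratio p) i i) / n ≤ τ) (hτ1 : τ ≤ 1 / 2) :
    chiSqDiv (permMixture P) (iidMixture P) ≤ ENNReal.ofReal (4 * τ ^ 2) := by
  rw [h.chiSqDiv_eq hn]
  exact ENNReal.ofReal_le_ofReal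
    (permMean_sub_one_le_sq hn (h.posSemidef_overlap hn) (h.sum_overlap hn) hτ hτ1)

theorem chiSqDiv_le_exp (hn : 1 ≤ n) (h : IsDensityFamily ν p P) {τ s : ℝ}
    (hτ : (∑ i, overlapMatrix (mix P) (ratio p) i i) / n ≤ τ)
    (hs : ∀ i j, Real.exp (-s) ≤ ∫ x, √(p i x * p j x) ∂ν) :
    chiSqDiv (permMixture P) (iidMixture P) ≤
      ENNReal.ofReal (Real.exp (τ * (2 + 4 * s)) - 1) := by
  rw [h.chiSqDiv_eq hn]
  refine ENNReal.ofReal_le_ofReal (sub_le_sub_right ?_ 1)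
  -- Affinity at least `e^{-s}` gives entries at least `δ = e^{-2s}`, so `2 + 2 log(1/δ) = 2 + 4s`.
  have h1 := permMean_le_exp hn (h.posSemidef_overlap hn) (h.sum_overlap hn) hτ
    (δ := Real.exp (-s) ^ 2) (by positivity)
    fun i j => h.sq_le_one_add_overlap hn (Real.exp_nonneg _) (hs i j)
  rw [← Real.exp_nat_mul, ← Real.exp_neg, Real.log_exp] at h1
  refine h1.trans_eq (congrArg _ ?_)
  push_cast
  ring

end IsDensityFamily

/-! ### Gaussian families. -/

theorem gaussianPDFReal_one (θ x : ℝ) :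
    gaussianPDFReal θ 1 x = (√(2 * Real.pi))⁻¹ * Real.exp (-(x - θ) ^ 2 / 2) := by
  simp [gaussianPDFReal]

theorem gaussianPDFReal_one_le (θ x : ℝ) : gaussianPDFReal θ 1 x ≤ 1 := by
  rw [gaussianPDFReal_one]
  have h1 : (√(2 * Real.pi))⁻¹ ≤ 1 := inv_le_one_of_one_le₀
    (Real.one_le_sqrt.2 (by linarith [Real.pi_gt_three]))
  have h2 : Real.exp (-(x - θ) ^ 2 / 2) ≤ 1 := Real.exp_le_one_iff.2 (by nlinarith [sq_nonneg (x - θ)])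
  exact mul_le_one₀ h1 (Real.exp_nonneg _) h2

theorem sq_gaussianPDFReal_div (θ θ' x : ℝ) :
    gaussianPDFReal θ 1 x ^ 2 / gaussianPDFReal θ' 1 x =
      Real.exp ((θ - θ') ^ 2) * gaussianPDFReal (2 * θ - θ') 1 x := by
  have hπ : (√(2 * Real.pi)) ≠ 0 := (Real.sqrt_pos.2 (by positivity)).ne'
  simp only [gaussianPDFReal_one]
  rw [div_eq_iff (by positivity), mul_pow, ← Real.exp_nat_mul]
  have : Real.exp ((2 : ℕ) * (-(x - θ) ^ 2 / 2)) = Real.exp ((θ - θ') ^ 2) *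
      Real.exp (-(x - (2 * θ - θ')) ^ 2 / 2) * Real.exp (-(x - θ') ^ 2 / 2) := by
    rw [← Real.exp_add, ← Real.exp_add]
    congr 1
    push_cast
    ring
  rw [this]
  ring

theorem sqrt_gaussianPDFReal_mul (θ θ' x : ℝ) :
    √(gaussianPDFReal θ 1 x * gaussianPDFReal θ' 1 x) =
      Real.exp (-((θ - θ') ^ 2 / 8)) * gaussianPDFReal ((θ + θ') / 2) 1 x := by
  have h0 : 0 ≤ Real.exp (-((θ - θ') ^ 2 / 8)) * gaussianPDFReal ((θ + θ') / 2) 1 x :=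
    mul_nonneg (Real.exp_nonneg _) (gaussianPDFReal_nonneg _ _ _)
  rw [← Real.sqrt_sq h0]
  congr 1
  simp only [gaussianPDFReal_one]
  have : Real.exp (-(x - θ) ^ 2 / 2) * Real.exp (-(x - θ') ^ 2 / 2) =
      (Real.exp (-((θ - θ') ^ 2 / 8)) * Real.exp (-(x - (θ + θ') / 2) ^ 2 / 2)) ^ 2 := by
    rw [← Real.exp_add, ← Real.exp_add, ← Real.exp_nat_mul]
    congr 1
    push_cast
    ring
  linear_combination ((√(2 * Real.pi))⁻¹) ^ 2 * this

theorem isDensityFamily_gaussianReal {n : ℕ} (θ : Fin n → ℝ) :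
    IsDensityFamily volume (fun i => gaussianPDFReal (θ i) 1) (fun i => gaussianReal (θ i) 1) where
  measurable _ := measurable_gaussianPDFReal _ _
  nonneg _ _ := gaussianPDFReal_nonneg _ _ _
  eq_withDensity _ := gaussianReal_of_var_ne_zero _ one_ne_zero
  isProbabilityMeasure _ := inferInstance

theorem le_integral_sqrt_gaussianPDFReal {θ θ' μ : ℝ} (h : |θ| ≤ μ) (h' : |θ'| ≤ μ) :
    Real.exp (-(μ ^ 2 / 2)) ≤ ∫ x, √(gaussianPDFReal θ 1 x * gaussianPDFReal θ' 1 x) := by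
  simp_rw [sqrt_gaussianPDFReal_mul]
  rw [integral_const_mul, integral_gaussianPDFReal_eq_one _ one_ne_zero, mul_one]
  rw [abs_le] at h h'
  refine Real.exp_le_exp.2 ?_
  nlinarith

/-- Outside `[-μ, μ]` the nearest endpoint is the mean with the largest density; inside, the crude
bound 1 costs only a mass linear in `μ`. -/
theorem gaussianPDFReal_le_of_abs_le {θ μ : ℝ} (h : |θ| ≤ μ) (x : ℝ) :
    gaussianPDFReal θ 1 x ≤ gaussianPDFReal μ 1 x + gaussianPDFReal (-μ) 1 x +
      (Set.Icc (-μ) μ).indicator 1 x := by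
  rw [abs_le] at h
  have h1 := gaussianPDFReal_nonneg μ 1 x
  have h2 := gaussianPDFReal_nonneg (-μ) 1 x
  by_cases hx : x ∈ Set.Icc (-μ) μ
  · rw [Set.indicator_of_mem hx]
    simp only [Pi.one_apply]
    linarith [gaussianPDFReal_one_le θ x]
  · rw [Set.indicator_of_notMem hx, add_zero]
    rw [Set.mem_Icc, not_and_or, not_le, not_le] at hx
    have hc : (0 : ℝ) ≤ (√(2 * Real.pi))⁻¹ := by positivity
    rcases hx with hx | hx
    · have : gaussianPDFReal θ 1 x ≤ gaussianPDFReal (-μ) 1 x := by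
        simp only [gaussianPDFReal_one]
        exact mul_le_mul_of_nonneg_left (Real.exp_le_exp.2 (by nlinarith)) hc
      linarith
    · have : gaussianPDFReal θ 1 x ≤ gaussianPDFReal μ 1 x := by
        simp only [gaussianPDFReal_one]
        exact mul_le_mul_of_nonneg_left (Real.exp_le_exp.2 (by nlinarith)) hc
      linarith

theorem exp_le_one_add_two_mul {y : ℝ} (h0 : 0 ≤ y) (h1 : y ≤ 1) : Real.exp y ≤ 1 + 2 * y := by
  have h := Real.abs_exp_sub_one_sub_id_le (x := y) (by rwa [abs_of_nonneg h0])
  nlinarith [(abs_le.1 h).2]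

theorem chiSqDiv_gaussian_le_of_le {n : ℕ} (hn : 1 ≤ n) {μ : ℝ} (hμ : μ ≤ 1 / 4)
    {P : Fin n → Measure ℝ} (hP : ∀ i, P i ∈ gaussianFamily μ) :
    chiSqDiv (permMixture P) (iidMixture P) ≤ ENNReal.ofReal (256 * μ ^ 4) := by
  choose θ hθ hPθ using hP
  obtain rfl : P = fun i => gaussianReal (θ i) 1 := funext hPθ
  have h := isDensityFamily_gaussianReal θ
  have hμ0 : 0 ≤ μ := (abs_nonneg _).trans (hθ ⟨0, hn⟩)
  -- Means differ by at most `2μ`, so the pairwise integrals are at most `exp(4μ²) ≤ 1 + 8μ²`. The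
  -- threshold `1/4` is where `8μ² = 1/2`, and `4 · 8² = 256`.
  have htr := h.trace_le_of_integral_sq_div hn (τ := 8 * μ ^ 2)
    (fun i x => gaussianPDFReal_pos _ _ _ one_ne_zero)
    (fun i j => by
      simp_rw [sq_gaussianPDFReal_div]
      exact (integrable_gaussianPDFReal _ _).const_mul _)
    (fun i j => by
      simp_rw [sq_gaussianPDFReal_div]
      rw [integral_const_mul, integral_gaussianPDFReal_eq_one _ one_ne_zero, mul_one]
      have h1 := abs_le.1 (hθ i)
      have h2 := abs_le.1 (hθ j)
      calc Real.exp ((θ i - θ j) ^ 2) ≤ Real.exp (4 * μ ^ 2) := Real.exp_le_exp.2 (by nlinarith)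
        _ ≤ 1 + 2 * (4 * μ ^ 2) := exp_le_one_add_two_mul (by positivity) (by nlinarith)
        _ = 1 + 8 * μ ^ 2 := by ring)
  refine (h.chiSqDiv_le_sq hn htr (by nlinarith)).trans_eq ?_
  congr 1
  ring

theorem chiSqDiv_gaussian_le_exp {n : ℕ} (hn : 1 ≤ n) {μ : ℝ} (hμ : 1 / 4 < μ)
    {P : Fin n → Measure ℝ} (hP : ∀ i, P i ∈ gaussianFamily μ) :
    chiSqDiv (permMixture P) (iidMixture P) ≤ ENNReal.ofReal (Real.exp (256 * μ ^ 3) - 1) := by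
  choose θ hθ hPθ using hP
  obtain rfl : P = fun i => gaussianReal (θ i) 1 := funext hPθ
  have h := isDensityFamily_gaussianReal θ
  have hind : Integrable ((Set.Icc (-μ) μ).indicator (1 : ℝ → ℝ)) volume :=
    (integrable_indicator_iff measurableSet_Icc).2 (integrableOn_const (by simp))
  have hsum : Integrable (fun x => gaussianPDFReal μ 1 x + gaussianPDFReal (-μ) 1 x) volume :=
    (integrable_gaussianPDFReal _ _).add (integrable_gaussianPDFReal _ _)
  -- The envelope has mass `1 + 1 + 2μ`. Below, `μ > 1/4` absorbs the lower order terms into `6μ ·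
  -- 34μ²`.
  have htr := h.trace_le_of_envelope hn (τ := 1 + 2 * μ) (hsum.add hind)
    (fun i x => gaussianPDFReal_le_of_abs_le (hθ i) x) (by
      refine le_of_eq ((integral_add hsum hind).trans ?_)
      rw [integral_add (integrable_gaussianPDFReal _ _) (integrable_gaussianPDFReal _ _),
        integral_gaussianPDFReal_eq_one _ one_ne_zero, integral_gaussianPDFReal_eq_one _ one_ne_zero,
        integral_indicator_one measurableSet_Icc, Real.volume_real_Icc_of_le (by linarith)]
      ring)
  refine (h.chiSqDiv_le_exp hn htr fun i j =>
    le_integral_sqrt_gaussianPDFReal (hθ i) (hθ j)).trans (ENNReal.ofReal_le_ofReal ?_)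
  refine sub_le_sub_right (Real.exp_le_exp.2 ?_) 1
  have h1 : 1 + 2 * μ ≤ 6 * μ := by linarith
  have h2 : 2 + 4 * (μ ^ 2 / 2) ≤ 34 * μ ^ 2 := by nlinarith
  calc (1 + 2 * μ) * (2 + 4 * (μ ^ 2 / 2)) ≤ 6 * μ * (34 * μ ^ 2) := by gcongr
    _ ≤ 256 * μ ^ 3 := by nlinarith [pow_pos (by linarith : 0 < μ) 3]

theorem chiSqDiv_gaussianFinite_le_exp {n : ℕ} (hn : 1 ≤ n) {μ : ℝ} (hμ : 1 / 4 < μ) {Θ : Finset ℝ}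
    {P : Fin n → Measure ℝ} (hP : ∀ i, P i ∈ gaussianFiniteFamily Θ μ) :
    chiSqDiv (permMixture P) (iidMixture P) ≤
      ENNReal.ofReal (Real.exp (256 * ((Θ.card : ℝ) * μ ^ 2)) - 1) := by
  choose θ hΘ hθ hPθ using hP
  obtain rfl : P = fun i => gaussianReal (θ i) 1 := funext hPθ
  have h := isDensityFamily_gaussianReal θ
  -- The sum of the densities over `Θ` is an envelope of mass `|Θ|`, replacing the factor of order
  -- `μ`.
  have htr := h.trace_le_of_envelope hn (τ := Θ.card)
    (integrable_finsetSum Θ fun t _ => integrable_gaussianPDFReal t 1)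
    (fun i x => Finset.single_le_sum (f := fun t => gaussianPDFReal t 1 x)
      (fun t _ => gaussianPDFReal_nonneg t 1 x) (hΘ i)) (by
      rw [integral_finsetSum _ fun t _ => integrable_gaussianPDFReal t 1]
      simp [integral_gaussianPDFReal_eq_one])
  refine (h.chiSqDiv_le_exp hn htr fun i j =>
    le_integral_sqrt_gaussianPDFReal (hθ i) (hθ j)).trans (ENNReal.ofReal_le_ofReal ?_)
  refine sub_le_sub_right (Real.exp_le_exp.2 ?_) 1
  have h2 : 2 + 4 * (μ ^ 2 / 2) ≤ 256 * μ ^ 2 := by nlinarith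
  calc (Θ.card : ℝ) * (2 + 4 * (μ ^ 2 / 2)) ≤ Θ.card * (256 * μ ^ 2) := by gcongr
    _ = _ := by ring

/-! ### The Bernoulli family. -/

/-- The mass function of the Bernoulli distribution. -/
def bernoulliMass (p : ℝ) (b : Bool) : ℝ := if b then p else 1 - p

theorem bernoulliMeasure_eq_withDensity (p : unitInterval) :
    bernoulliMeasure true false p =
      Measure.count.withDensity fun b => ENNReal.ofReal (bernoulliMass p b) := by
  rw [count_withDensity, Measure.sum_fintype, Fintype.sum_bool, bernoulliMeasure_def]
  congr 1
  · simp only [bernoulliMass, if_true]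
    rw [← unitInterval.coe_toNNReal, ENNReal.ofReal_coe_nnreal]
    rfl
  · simp only [bernoulliMass, Bool.false_eq_true, if_false]
    rw [← unitInterval.coe_symm_eq, ← unitInterval.coe_toNNReal, ENNReal.ofReal_coe_nnreal]
    rfl

theorem isDensityFamily_bernoulliMeasure {n : ℕ} (p : Fin n → unitInterval) :
    IsDensityFamily Measure.count (fun i => bernoulliMass (p i))
      (fun i => bernoulliMeasure true false (p i)) where
  measurable _ := measurable_of_countable _
  nonneg i b := by
    have h0 := (p i).2.1
    have h1 := (p i).2.2
    cases b <;> simp [bernoulliMass, h0, h1]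
  eq_withDensity i := bernoulliMeasure_eq_withDensity (p i)
  isProbabilityMeasure _ := inferInstance

theorem chiSqDiv_bernoulli_le_pow {n : ℕ} (hn : 1 ≤ n) {ε : ℝ} (hε : 2 / 5 ≤ ε)
    {P : Fin n → Measure Bool} (hP : ∀ i, P i ∈ bernoulliFamily ε) :
    chiSqDiv (permMixture P) (iidMixture P) ≤ ENNReal.ofReal (100 * (1 - 2 * ε) ^ 4) := by
  choose p hp hPp using hP
  obtain rfl : P = fun i => bernoulliMeasure true false (p i) := funext hPp
  have h := isDensityFamily_bernoulliMeasure p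
  have hε2 : ε ≤ 1 / 2 := by linarith [(hp ⟨0, hn⟩).1, (hp ⟨0, hn⟩).2]
  -- The pairwise divergence is `(x - y)² / (y(1 - y))`, and `ε ≥ 2/5` keeps the denominator above
  -- `1/5` and `τ` below `1/2`.
  have htr := h.trace_le_of_integral_sq_div hn (τ := 5 * (1 - 2 * ε) ^ 2)
    (fun i b => by
      have h1 := (hp i).1
      have h2 := (hp i).2
      cases b
      · simp only [bernoulliMass, Bool.false_eq_true, if_false]; linarith
      · simp only [bernoulliMass, if_true]; linarith)
    (fun i j => integrable_count_iff.2 (Summable.of_finite))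
    (fun i j => by
      rw [integral_count, Fintype.sum_bool]
      simp only [bernoulliMass, Bool.false_eq_true, if_false, if_true]
      obtain ⟨h1, h2⟩ := hp i
      obtain ⟨h3, h4⟩ := hp j
      generalize (p i : ℝ) = x at *
      generalize (p j : ℝ) = y at *
      have hy : 0 < y := by linarith
      have hy1 : 0 < 1 - y := by linarith
      have hsq : (x - y) ^ 2 ≤ (1 - 2 * ε) ^ 2 := by nlinarith
      have hden : 1 / 5 ≤ y * (1 - y) := by nlinarith
      have heq : x ^ 2 / y + (1 - x) ^ 2 / (1 - y) = 1 + (x - y) ^ 2 / (y * (1 - y)) := by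
        field_simp
        ring
      rw [heq]
      have : (x - y) ^ 2 / (y * (1 - y)) ≤ 5 * (1 - 2 * ε) ^ 2 := by
        rw [div_le_iff₀ (mul_pos hy hy1)]
        nlinarith [mul_le_mul hsq hden (by norm_num) (sq_nonneg (1 - 2 * ε))]
      linarith)
  refine (h.chiSqDiv_le_sq hn htr (by nlinarith)).trans_eq ?_
  congr 1
  ring

theorem chiSqDiv_bernoulli_le_inv {n : ℕ} (hn : 1 ≤ n) {ε : ℝ} (hε : 0 < ε)
    {P : Fin n → Measure Bool} (hP : ∀ i, P i ∈ bernoulliFamily ε) :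
    chiSqDiv (permMixture P) (iidMixture P) ≤ ENNReal.ofReal (2 * ε)⁻¹ := by
  choose p hp hPp using hP
  obtain rfl : P = fun i => bernoulliMeasure true false (p i) := funext hPp
  have h := isDensityFamily_bernoulliMeasure p
  -- Both outcomes have mass at most `1 - ε`, so the envelope has mass `2 - 2ε`. The trace stays
  -- below 1, and no spectral gap is needed.
  have htr := h.trace_le_of_envelope hn (τ := 1 - 2 * ε) (e := fun _ => 1 - ε)
    (integrable_count_iff.2 Summable.of_finite)
    (fun i b => by
      have h1 := (hp i).1
      have h2 := (hp i).2
      cases b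
      · simp only [bernoulliMass, Bool.false_eq_true, if_false]; linarith
      · simp only [bernoulliMass, if_true]; linarith)
    (by rw [integral_count, Fintype.sum_bool]; linarith)
  have := h.chiSqDiv_le_inv_one_sub hn htr (by linarith)
  rwa [sub_sub_cancel] at this

/-! ### The Poisson family. -/

/-- The mass function of the Poisson distribution. -/
noncomputable def poissonMass (r : ℝ≥0) (k : ℕ) : ℝ := Real.exp (-r) * r ^ k / k.factorial

theorem hasSum_poissonMass (r : ℝ≥0) : HasSum (poissonMass r) 1 := hasSum_one_poissonMeasure r

theorem poissonMass_nonneg (r : ℝ≥0) (k : ℕ) : 0 ≤ poissonMass r k := by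
  unfold poissonMass; positivity

theorem isDensityFamily_poissonMeasure {n : ℕ} (r : Fin n → ℝ≥0) :
    IsDensityFamily Measure.count (fun i => poissonMass (r i))
      (fun i => poissonMeasure (r i)) where
  measurable _ := measurable_of_countable _
  nonneg i := poissonMass_nonneg (r i)
  eq_withDensity i := by rw [count_withDensity]; rfl
  isProbabilityMeasure _ := inferInstance

theorem integrable_count_of_hasSum {f : ℕ → ℝ} {s : ℝ} (h0 : ∀ k, 0 ≤ f k) (hf : HasSum f s) :
    Integrable f Measure.count := by
  rw [integrable_count_iff]
  simp_rw [Real.norm_of_nonneg (h0 _)]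
  exact hf.summable

theorem integral_count_of_hasSum {f : ℕ → ℝ} {s : ℝ} (h0 : ∀ k, 0 ≤ f k) (hf : HasSum f s) :
    ∫ k, f k ∂Measure.count = s := by
  rw [integral_countable (integrable_count_of_hasSum h0 hf)]
  simp [hf.tsum_eq]

/-- The geometric mean of two Poisson mass functions is proportional to the one whose rate is the
geometric mean, so the affinity is the prefactor. -/
theorem sqrt_poissonMass_mul (r r' : ℝ≥0) (k : ℕ) :
    √(poissonMass r k * poissonMass r' k) =
      Real.exp (NNReal.sqrt (r * r') - ((r : ℝ) + r') / 2) * poissonMass (NNReal.sqrt (r * r')) k := by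
  have h0 : 0 ≤ Real.exp (NNReal.sqrt (r * r') - ((r : ℝ) + r') / 2) *
      poissonMass (NNReal.sqrt (r * r')) k :=
    mul_nonneg (Real.exp_nonneg _) (poissonMass_nonneg _ _)
  rw [← Real.sqrt_sq h0]
  congr 1
  have hs : ((NNReal.sqrt (r * r') : ℝ≥0) : ℝ) ^ 2 = r * r' := by
    rw [← NNReal.coe_pow, NNReal.sq_sqrt]; push_cast; rfl
  unfold poissonMass
  generalize ((NNReal.sqrt (r * r') : ℝ≥0) : ℝ) = u at hs
  have hu : (u ^ k) ^ 2 = (r : ℝ) ^ k * (r' : ℝ) ^ k := by rw [← mul_pow, ← hs, pow_right_comm]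
  have he : (Real.exp (u - ((r : ℝ) + r') / 2) * Real.exp (-u)) ^ 2 =
      Real.exp (-r) * Real.exp (-r') := by
    rw [← Real.exp_add, ← Real.exp_add, ← Real.exp_nat_mul]
    congr 1
    push_cast
    ring
  calc Real.exp (-r) * (r : ℝ) ^ k / k.factorial * (Real.exp (-r') * (r' : ℝ) ^ k / k.factorial)
      = (Real.exp (-r) * Real.exp (-r')) * ((r : ℝ) ^ k * (r' : ℝ) ^ k) /
          (k.factorial : ℝ) ^ 2 := by ring
    _ = _ := by rw [← he, ← hu]; ring

/-- The geometric mean of the rates is at least the smaller one, so the exponent is at least minus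
half the difference of the rates. -/
theorem le_integral_sqrt_poissonMass {r r' : ℝ≥0} {M : ℝ} (h : (r : ℝ) ≤ M) (h' : (r' : ℝ) ≤ M) :
    Real.exp (-(M / 2)) ≤ ∫ k, √(poissonMass r k * poissonMass r' k) ∂Measure.count := by
  simp_rw [sqrt_poissonMass_mul]
  rw [integral_const_mul, integral_count_of_hasSum (poissonMass_nonneg _) (hasSum_poissonMass _),
    mul_one]
  refine Real.exp_le_exp.2 ?_
  have hs : min (r : ℝ) r' ≤ NNReal.sqrt (r * r') := by
    rw [Real.coe_sqrt]
    refine Real.le_sqrt_of_sq_le ?_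
    push_cast
    rw [sq]
    exact mul_le_mul (min_le_left _ _) (min_le_right _ _) (le_min r.2 r'.2) r.2
  rcases le_total (r : ℝ) r' with hr | hr
  · rw [min_eq_left hr] at hs; linarith [r.2]
  · rw [min_eq_right hr] at hs; linarith [r'.2]

theorem chiSqDiv_poisson_le_sq {n : ℕ} (hn : 1 ≤ n) {M : ℝ} (hM : M ≤ 1)
    {P : Fin n → Measure ℕ} (hP : ∀ i, P i ∈ poissonFamily M) :
    chiSqDiv (permMixture P) (iidMixture P) ≤ ENNReal.ofReal (16 * Real.exp 8 * M ^ 2) := by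
  choose r hr hPr using hP
  obtain rfl : P = fun i => poissonMeasure (r i) := funext hPr
  have h := isDensityFamily_poissonMeasure r
  have hM0 : 0 ≤ M := (r ⟨0, hn⟩).2.trans (hr ⟨0, hn⟩)
  lift M to ℝ≥0 using hM0
  have he : HasSum (fun k : ℕ => Real.exp M * poissonMass M k) (Real.exp M) := by
    simpa using (hasSum_poissonMass M).mul_left (Real.exp M)
  have he0 : ∀ k, 0 ≤ Real.exp M * poissonMass M k := fun k =>
    mul_nonneg (Real.exp_nonneg _) (poissonMass_nonneg _ _)
  -- Dropping `e^{-r}` gives the envelope `M^k / k!`, of mass `e^M ≤ 1 + 2M`.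
  have htr := h.trace_le_of_envelope hn (τ := 2 * M) (integrable_count_of_hasSum he0 he)
    (fun i k => by
      have h1 : Real.exp M * poissonMass M k = (M : ℝ) ^ k / k.factorial := by
        rw [poissonMass, ← mul_div_assoc, ← mul_assoc, ← Real.exp_add, add_neg_cancel,
          Real.exp_zero, one_mul]
      rw [h1, poissonMass]
      gcongr
      calc Real.exp (-(r i)) * (r i : ℝ) ^ k ≤ 1 * (M : ℝ) ^ k :=
            mul_le_mul (Real.exp_le_one_iff.2 (neg_nonpos.2 (r i).2))
              (pow_le_pow_left₀ (r i).2 (hr i) k) (by positivity) zero_le_one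
        _ = (M : ℝ) ^ k := one_mul _)
    (by
      rw [integral_count_of_hasSum he0 he]
      exact exp_le_one_add_two_mul M.2 hM)
  have he1 : 1 ≤ Real.exp 8 := Real.one_le_exp (by norm_num)
  have hM0 : (0 : ℝ) ≤ M := M.2
  -- For `M ≤ 1/4` the quadratic bound applies with `τ = 2M`. On `(1/4, 1]` a constant bound is
  -- enough: the exponent `2M(2 + 2M)` is at most 8 and `16M² ≥ 1`.
  rcases le_or_gt (M : ℝ) (1 / 4) with hM4 | hM4
  · refine (h.chiSqDiv_le_sq hn htr (by linarith)).trans (ENNReal.ofReal_le_ofReal ?_)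
    nlinarith [mul_le_mul_of_nonneg_right he1 (sq_nonneg (M : ℝ))]
  · refine (h.chiSqDiv_le_exp hn htr fun i j =>
      le_integral_sqrt_poissonMass (hr i) (hr j)).trans (ENNReal.ofReal_le_ofReal ?_)
    have h1 : Real.exp (2 * M * (2 + 4 * (M / 2))) ≤ Real.exp 8 :=
      Real.exp_le_exp.2 (by nlinarith)
    have h2 : 1 ≤ 16 * (M : ℝ) ^ 2 := by nlinarith
    nlinarith [mul_le_mul_of_nonneg_left h2 (Real.exp_nonneg 8)]

/-- As a function of the rate, the mass at `k` is unimodal with peak at `k`; the hypothesis says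
that `y` lies between `x` and `k`. The proof is `1 + u ≤ e^u` raised to the power `k`. -/
theorem exp_neg_mul_pow_le {x y : ℝ} (hx : 0 ≤ x) (hy : 0 < y) {k : ℕ}
    (hk : (k - y) * (x - y) ≤ 0) : Real.exp (-x) * x ^ k ≤ Real.exp (-y) * y ^ k := by
  have h1 : x / y ≤ Real.exp (x / y - 1) := by linarith [Real.add_one_le_exp (x / y - 1)]
  have h2 := pow_le_pow_left₀ (div_nonneg hx hy.le) h1 k
  rw [← Real.exp_nat_mul, div_pow, div_le_iff₀ (pow_pos hy k)] at h2
  have h3 : (k : ℝ) * (x / y - 1) ≤ x - y := by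
    rw [div_sub_one hy.ne', mul_div_assoc', div_le_iff₀ hy]
    nlinarith
  calc Real.exp (-x) * x ^ k ≤ Real.exp (-x) * (Real.exp (x - y) * y ^ k) := by
        refine mul_le_mul_of_nonneg_left (h2.trans ?_) (Real.exp_nonneg _)
        exact mul_le_mul_of_nonneg_right (Real.exp_le_exp.2 h3) (by positivity)
    _ = Real.exp (-y) * y ^ k := by
        rw [← mul_assoc, ← Real.exp_add]; congr 2; ring

/-- A bound on the mass at `k` of all Poisson distributions. -/
noncomputable def poissonPeak (k : ℕ) : ℝ := if k = 0 then 1 else (√k)⁻¹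

theorem poissonPeak_nonneg (k : ℕ) : 0 ≤ poissonPeak k := by
  unfold poissonPeak; split_ifs <;> positivity

/-- The worst rate is `r = k`, where Stirling's lower bound for `k!` gives decay `1/√k`. -/
theorem poissonMass_le_peak (r : ℝ≥0) (k : ℕ) : poissonMass r k ≤ poissonPeak k := by
  rw [poissonMass, poissonPeak]
  split_ifs with hk
  · subst hk
    simp
  · have hk0 : (0 : ℝ) < k := by positivity
    have h1 := exp_neg_mul_pow_le r.2 hk0 (k := k) (by simp)
    have h2 := Stirling.le_factorial_stirling k
    have h3 : Real.exp (-k) * (k : ℝ) ^ k = (k / Real.exp 1) ^ k := by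
      rw [div_pow, ← Real.exp_nat_mul, mul_one, Real.exp_neg]
      ring
    have h4 : √(k : ℝ) ≤ √(2 * Real.pi * k) := Real.sqrt_le_sqrt (by nlinarith [Real.pi_gt_three])
    have hs : 0 < √(k : ℝ) := Real.sqrt_pos.2 hk0
    rw [div_le_iff₀ (by positivity), inv_mul_eq_div, le_div_iff₀ hs]
    calc Real.exp (-r) * (r : ℝ) ^ k * √k ≤ (k / Real.exp 1) ^ k * √(2 * Real.pi * k) := by
          rw [← h3]
          exact mul_le_mul h1 h4 hs.le (by positivity)
      _ ≤ k.factorial := by linarith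

theorem sum_poissonPeak_le (N : ℕ) : ∑ k ∈ Finset.range (N + 1), poissonPeak k ≤ 1 + 2 * √N := by
  induction N with
  | zero => simp [poissonPeak]
  | succ N ih =>
    rw [Finset.sum_range_succ]
    -- Telescoping comparison of `1/√k` with its integral.
    have h1 : poissonPeak (N + 1) ≤ 2 * (√((N + 1 : ℕ) : ℝ) - √N) := by
      rw [poissonPeak, if_neg (Nat.succ_ne_zero N)]
      have ha : 0 < √((N + 1 : ℕ) : ℝ) := Real.sqrt_pos.2 (by positivity)
      have hb : 0 ≤ √(N : ℝ) := Real.sqrt_nonneg _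
      have ha2 : √((N + 1 : ℕ) : ℝ) ^ 2 = N + 1 := by
        rw [Real.sq_sqrt (by positivity)]; push_cast; rfl
      have hb2 : √(N : ℝ) ^ 2 = N := Real.sq_sqrt (by positivity)
      rw [inv_le_iff_one_le_mul₀ ha]
      nlinarith [sq_nonneg (√((N + 1 : ℕ) : ℝ) - √N)]
    linarith

theorem chiSqDiv_poisson_le_exp {n : ℕ} (hn : 1 ≤ n) {M : ℝ} (hM : 1 < M)
    {P : Fin n → Measure ℕ} (hP : ∀ i, P i ∈ poissonFamily M) :
    chiSqDiv (permMixture P) (iidMixture P) ≤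
      ENNReal.ofReal (Real.exp (12 * M ^ (3 / 2 : ℝ)) - 1) := by
  choose r hr hPr using hP
  obtain rfl : P = fun i => poissonMeasure (r i) := funext hPr
  have h := isDensityFamily_poissonMeasure r
  lift M to ℝ≥0 using (zero_lt_one.trans hM).le
  have hM0 : (0 : ℝ) < M := zero_lt_one.trans hM
  -- The envelope is the mass function of rate `M`, which dominates for `k > M`, plus the peak bound
  -- for `k ≤ M`. Its mass is at most `1 + (1 + 2√M)`.
  let c : ℕ → ℝ := fun k => if k ∈ Finset.range (⌊(M : ℝ)⌋₊ + 1) then poissonPeak k else 0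
  have hc0 : ∀ k, 0 ≤ c k := fun k => by
    simp only [c]; split_ifs
    · exact poissonPeak_nonneg k
    · exact le_rfl
  have hc : HasSum c (∑ k ∈ Finset.range (⌊(M : ℝ)⌋₊ + 1), poissonPeak k) := by
    have hsum : HasSum c (∑ k ∈ Finset.range (⌊(M : ℝ)⌋₊ + 1), c k) :=
      hasSum_sum_of_ne_finset_zero fun k hk => if_neg hk
    rwa [Finset.sum_congr rfl fun k hk => if_pos hk] at hsum
  have he := (hasSum_poissonMass M).add hc
  have he0 : ∀ k, 0 ≤ poissonMass M k + c k := fun k => add_nonneg (poissonMass_nonneg _ _) (hc0 k)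
  have hfloor : √(⌊(M : ℝ)⌋₊ : ℝ) ≤ √(M : ℝ) := Real.sqrt_le_sqrt (Nat.floor_le hM0.le)
  have htr := h.trace_le_of_envelope hn (τ := 1 + 2 * √(M : ℝ)) (integrable_count_of_hasSum he0 he)
    (fun i k => by
      by_cases hk : k ∈ Finset.range (⌊(M : ℝ)⌋₊ + 1)
      · have : c k = poissonPeak k := if_pos hk
        rw [this]
        linarith [poissonMass_le_peak (r i) k, poissonMass_nonneg M k]
      · have hMk : (M : ℝ) ≤ k := by
          rw [Finset.mem_range, not_lt] at hk
          exact (Nat.lt_of_floor_lt hk).le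
        refine le_add_of_le_of_nonneg ?_ (hc0 k)
        unfold poissonMass
        refine div_le_div_of_nonneg_right (exp_neg_mul_pow_le (r i).2 hM0 ?_) (by positivity)
        exact mul_nonpos_of_nonneg_of_nonpos (sub_nonneg.2 hMk) (sub_nonpos.2 (hr i)))
    (by
      rw [integral_count_of_hasSum he0 he]
      linarith [sum_poissonPeak_le ⌊(M : ℝ)⌋₊])
  refine (h.chiSqDiv_le_exp hn htr fun i j =>
    le_integral_sqrt_poissonMass (hr i) (hr j)).trans (ENNReal.ofReal_le_ofReal ?_)
  refine sub_le_sub_right (Real.exp_le_exp.2 ?_) 1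
  have hpow : (M : ℝ) ^ (3 / 2 : ℝ) = √(M : ℝ) * M := by
    rw [show (3 / 2 : ℝ) = 1 / 2 + 1 by norm_num, Real.rpow_add hM0, Real.rpow_one,
      Real.sqrt_eq_rpow]
  have hs : 1 ≤ √(M : ℝ) := Real.one_le_sqrt.2 hM.le
  rw [hpow]
  calc (1 + 2 * √(M : ℝ)) * (2 + 4 * ((M : ℝ) / 2)) ≤ (3 * √(M : ℝ)) * (4 * M) := by
        gcongr <;> linarith
    _ = 12 * (√(M : ℝ) * M) := by ring

/-! ### The four bounds with explicit constants. -/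

theorem mainTheorem7 :
    -- Gaussian family
    (∃ μc : ℝ, 0 < μc ∧ ∃ C : ℝ, 0 < C ∧
      ∀ (μ : ℝ) (n : ℕ), 1 ≤ n → ∀ P : Fin n → Measure ℝ, (∀ i, P i ∈ gaussianFamily μ) →
        (μ ≤ μc →
          chiSqDiv (permMixture P) (iidMixture P) ≤ ENNReal.ofReal (C * μ ^ 4)) ∧
        (μc < μ →
          chiSqDiv (permMixture P) (iidMixture P) ≤ ENNReal.ofReal (Real.exp (C * μ ^ 3) - 1))) ∧
    -- Gaussian family with finite support
    (∃ μc : ℝ, 0 < μc ∧ ∃ C : ℝ, 0 < C ∧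
      ∀ (Θ : Finset ℝ) (μ : ℝ) (n : ℕ), 1 ≤ n →
        ∀ P : Fin n → Measure ℝ, (∀ i, P i ∈ gaussianFiniteFamily Θ μ) →
          (μ ≤ μc →
            chiSqDiv (permMixture P) (iidMixture P) ≤ ENNReal.ofReal (C * μ ^ 4)) ∧
          (μc < μ →
            chiSqDiv (permMixture P) (iidMixture P) ≤
              ENNReal.ofReal (Real.exp (C * ((Θ.card : ℝ) * μ ^ 2)) - 1))) ∧
    -- Bernoulli family
    (∃ εc : ℝ, 0 < εc ∧ εc < 1 / 2 ∧ ∃ C : ℝ, 0 < C ∧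
      ∀ (ε : ℝ) (n : ℕ), 1 ≤ n → ∀ P : Fin n → Measure Bool, (∀ i, P i ∈ bernoulliFamily ε) →
        (εc ≤ ε →
          chiSqDiv (permMixture P) (iidMixture P) ≤ ENNReal.ofReal (C * (1 - 2 * ε) ^ 4)) ∧
        (0 < ε → ε < εc →
          chiSqDiv (permMixture P) (iidMixture P) ≤ ENNReal.ofReal (C * (1 / ε)))) ∧
    -- Poisson family
    (∃ C : ℝ, 0 < C ∧
      ∀ (M : ℝ) (n : ℕ), 1 ≤ n → ∀ P : Fin n → Measure ℕ, (∀ i, P i ∈ poissonFamily M) →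
        (M ≤ 1 →
          chiSqDiv (permMixture P) (iidMixture P) ≤ ENNReal.ofReal (C * M ^ 2)) ∧
        (1 < M →
          chiSqDiv (permMixture P) (iidMixture P) ≤
            ENNReal.ofReal (Real.exp (C * M ^ (3 / 2 : ℝ)) - 1))) := by
  refine ⟨⟨1 / 4, by norm_num, 256, by norm_num, fun μ n hn P hP =>
      ⟨fun hμ => chiSqDiv_gaussian_le_of_le hn hμ hP,
        fun hμ => chiSqDiv_gaussian_le_exp hn hμ hP⟩⟩,
    ⟨1 / 4, by norm_num, 256, by norm_num, fun Θ μ n hn P hP =>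
      ⟨fun hμ => chiSqDiv_gaussian_le_of_le hn hμ fun i => ?_,
        fun hμ => chiSqDiv_gaussianFinite_le_exp hn hμ hP⟩⟩,
    ⟨2 / 5, by norm_num, by norm_num, 100, by norm_num, fun ε n hn P hP =>
      ⟨fun hε => chiSqDiv_bernoulli_le_pow hn hε hP,
        fun hε _ => (chiSqDiv_bernoulli_le_inv hn hε hP).trans (ENNReal.ofReal_le_ofReal ?_)⟩⟩,
    ⟨16 * Real.exp 8, by positivity, fun M n hn P hP =>
      ⟨fun hM => chiSqDiv_poisson_le_sq hn hM hP,
        fun hM => (chiSqDiv_poisson_le_exp hn hM hP).trans (ENNReal.ofReal_le_ofReal ?_)⟩⟩⟩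
  · obtain ⟨θ, -, hθ, hPθ⟩ := hP i
    exact ⟨θ, hθ, hPθ⟩
  · rw [mul_inv, one_div]
    nlinarith [inv_pos.2 hε]
  · have h1 : (12 : ℝ) ≤ 16 * Real.exp 8 := by linarith [Real.one_le_exp (x := 8) (by norm_num)]
    gcongr
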